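/- Consider systems of the form $$ \begin{aligned} \dot{x}_1 &= f_1(x_1,x_2,x_3,u) + S(x,u), & \dot{x}_2 &= A_2 x_2 + f_2(x_1,u),\\ \dot{x}_3 &= A_3 x_3 + f_3(x_1,x_2,u), & \dot{x}_4 &= f_4(x_1,x_2,x_3,u), \qquad y = x_1, \end{aligned} $$ with $x=\mathrm{col}(x_1,x_2,x_3,x_4)$, $x_i(t)\in\mathbb{R}^{n_i}$, $u(t)\in\mathbb{R}^m$, all mappings smooth, and $u$ continuous on $[0,\infty)$. Assume: (i) there are $1\le k\le n_1$ and a smooth mapping $b:\mathbb{R}^{n_1}\times\mathbb{R}^{n_2}\times\mathbb{R}^{n_3}\times\mathbb{R}^m\to\mathbb{R}^{n_4}$ such that the $k$-th component of $S$ satisfies $S_k(x,u)=b^\top(x_1,x_2,x_3,u)\,x_4$ for all $(x,u)$; (ii) the matrices $A_2$ and $A_3$ are Hurwitz; (iii) the input $u$ and the trajectory $x$ are bounded on $[0,\infty)$; the signal $b(t):=b(x_1(t),x_2(t),x_3(t),u(t))$ is uniformly continuous on $[0,\infty)$ and persistently exciting, that is, for some $\delta,T>0$, $$\int_t^{t+T}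 b(s)b^\top(s)\,ds \ge \delta I_{n_4}\qquad\text{for all } t\ge 0 .$$ Let $\alpha>0$, let $\Gamma\in\mathbb{R}^{n_4\times n_4}$ be symmetric positive definite, and for a signal $w$ let $\frac{\alpha}{p+\alpha}[w]$ be any solution $z$ of $\dot z=-\alpha z+\alpha w$ (arbitrary initial condition) and $\frac{\alpha p}{p+\alpha}[w]:=\alpha\big(w-\frac{\alpha}{p+\alpha}[w]\big)$. Consider the observer, driven by $y$ and $u$ only, $$ \begin{aligned} \dot{\hat x}_2 &= A_2\hat x_2+f_2(y,u), & \dot{\hat x}_3 &= A_3\hat x_3+f_3(y,\hat x_2,u),\\ \dot{\xi} &= f_4(y,\hat x_2,\hat x_3,u), & \dot{\hat\theta} &= \Gamma\hat\psi\,(\hat Y-\hat\psi^\top\hat\theta), \qquad \hat x_4=\xi+\hat\theta, \end{aligned} $$ where $$ \begin{aligned} \hat Y &:= \tfrac{\alpha p}{p+\alpha}[y_k]-\tfrac{\alpha}{p+\alpha}\big[f_{1,k}(y,\hat x_2,\hat x_3,u)\big]-\tfrac{\alpha}{p+\alpha}\big[b^\top(y,\hat x_2,\hat x_3,u)\,\xi\big],\\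 \hat\psi &:= \tfrac{\alpha}{p+\alpha}\big[b(y,\hat x_2,\hat x_3,u)\big]. \end{aligned} $$ Then, from every initial condition of $\hat x_2,\hat x_3,\xi,\hat\theta$ and of the four filters, the observer has a solution on $[0,\infty)$, and along every such solution all observer states are bounded, there is a constant vector $\theta\in\mathbb{R}^{n_4}$ with $x_4(t)-\xi(t)\to\theta$ and $\hat\theta(t)\to\theta$, and $$\lim_{t\to\infty}|\hat x_i(t)-x_i(t)|=0,\qquad i=2,3,4 .$$ -/

import Mathlib

open Set Filter Topology
open scoped ContDiff

namespace KKLPEB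

/-- `ℝⁿ` with the Euclidean norm. -/
abbrev E (n : ℕ) : Type := EuclideanSpace ℝ (Fin n)

/-- The state space of the plant, `x = col(x₁, x₂, x₃, x₄)`. -/
abbrev PlantState (n₁ n₂ n₃ n₄ : ℕ) : Type := E n₁ × E n₂ × E n₃ × E n₄

/-- A real square matrix is Hurwitz: all its complex eigenvalues have negative real part. -/
def IsHurwitz {n : ℕ} (A : Matrix (Fin n) (Fin n) ℝ) : Prop :=
  ∀ μ ∈ spectrum ℂ (A.map (algebraMap ℝ ℂ)), μ.re < 0

/-- The data of the cascade class: the matrices and the (smooth) mappings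
on the right-hand side. -/
structure CascadeSystem (n₁ n₂ n₃ n₄ m : ℕ) where
  A₂ : Matrix (Fin n₂) (Fin n₂) ℝ
  A₃ : Matrix (Fin n₃) (Fin n₃) ℝ
  f₁ : E n₁ × E n₂ × E n₃ × E m → E n₁
  S : PlantState n₁ n₂ n₃ n₄ × E m → E n₁
  f₂ : E n₁ × E m → E n₂
  f₃ : E n₁ × E n₂ × E m → E n₃
  f₄ : E n₁ × E n₂ × E n₃ × E m → E n₄
  smooth_f₁ : ContDiff ℝ ∞ f₁
  smooth_S : ContDiff ℝ ∞ S
  smooth_f₂ : ContDiff ℝ ∞ f₂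
  smooth_f₃ : ContDiff ℝ ∞ f₃
  smooth_f₄ : ContDiff ℝ ∞ f₄

/-- `z` solves `ż(t) = v(t, z(t))` on `[0, ∞)` (one-sided derivative at `0`). -/
def IsSolution {X : Type*} [NormedAddCommGroup X] [NormedSpace ℝ X]
    (v : ℝ → X → X) (z : ℝ → X) : Prop :=
  ∀ t ∈ Ici (0 : ℝ), HasDerivWithinAt z (v t (z t)) (Ici 0) t

/-- A signal is bounded on `[0, ∞)`. -/
def IsBoundedSignal {X : Type*} [NormedAddCommGroup X] (z : ℝ → X) : Prop :=
  ∃ C : ℝ, ∀ t ∈ Ici (0 : ℝ), ‖z t‖ ≤ C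

/-- Persistency of excitation: for some `T, δ > 0` the matrix inequality
`∫_t^{t+T} w(s) w(s)ᵀ ds ≥ δ I` holds for all `t ≥ 0`. -/
def IsPersistentlyExciting {n : ℕ} (w : ℝ → E n) : Prop :=
  ∃ T > (0 : ℝ), ∃ δ > (0 : ℝ), ∀ t ≥ (0 : ℝ),
    ((Matrix.of fun i j : Fin n => ∫ s in t..(t + T), w s i * w s j)
      - δ • (1 : Matrix (Fin n) (Fin n) ℝ)).PosSemidef

namespace CascadeSystem

variable {n₁ n₂ n₃ n₄ m : ℕ}

/-- The plant vector field. -/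
noncomputable def field (sys : CascadeSystem n₁ n₂ n₃ n₄ m) :
    PlantState n₁ n₂ n₃ n₄ → E m → PlantState n₁ n₂ n₃ n₄
  | (x₁, x₂, x₃, x₄), u =>
    (sys.f₁ (x₁, x₂, x₃, u) + sys.S ((x₁, x₂, x₃, x₄), u),
     Matrix.toEuclideanLin sys.A₂ x₂ + sys.f₂ (x₁, u),
     Matrix.toEuclideanLin sys.A₃ x₃ + sys.f₃ (x₁, x₂, u),
     sys.f₄ (x₁, x₂, x₃, u))

end CascadeSystem

/-- The state `χ = (x̂₂, x̂₃, ξ, z_y, z_f, z_b, ψ̂, θ̂)` of the observer. Here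
`z_y`, `z_f`, `z_b`, `ψ̂` are the states of the four first-order filters. -/
abbrev ObserverState (n₂ n₃ n₄ : ℕ) : Type :=
  E n₂ × E n₃ × E n₄ × ℝ × ℝ × ℝ × E n₄ × E n₄

/-- Right-hand side `-α z + α w` of the state equation of `z = α/(p+α)[w]`, `p = d/dt`. -/
def lowPass {X : Type*} [NormedAddCommGroup X] [NormedSpace ℝ X] (α : ℝ) (z w : X) : X :=
  -(α • z) + α • w

/-- The signal `Ŷ = αp/(p+α)[y_k] - α/(p+α)[f_{1,k}] - α/(p+α)[bᵀ ξ]`, where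
`αp/(p+α)[y_k] = α (y_k - α/(p+α)[y_k])`. -/
def regressand {n₁ : ℕ} (k : Fin n₁) (α : ℝ) (y : E n₁) (zy zf zb : ℝ) : ℝ :=
  α * (y k - zy) - zf - zb

/-- The observer dynamics `χ̇ = F(y, χ, u)`, driven by the measured `y` and `u` only. -/
noncomputable def observerField {n₁ n₂ n₃ n₄ m : ℕ} (sys : CascadeSystem n₁ n₂ n₃ n₄ m)
    (k : Fin n₁) (b : E n₁ × E n₂ × E n₃ × E m → E n₄)
    (α : ℝ) (Γ : Matrix (Fin n₄) (Fin n₄) ℝ) :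
    E n₁ → ObserverState n₂ n₃ n₄ → E m → ObserverState n₂ n₃ n₄
  | y, (x₂, x₃, ξ, zy, zf, zb, ψ, θ), u =>
    (Matrix.toEuclideanLin sys.A₂ x₂ + sys.f₂ (y, u),
     Matrix.toEuclideanLin sys.A₃ x₃ + sys.f₃ (y, x₂, u),
     sys.f₄ (y, x₂, x₃, u),
     lowPass α zy (y k),
     lowPass α zf (sys.f₁ (y, x₂, x₃, u) k),
     lowPass α zb (inner ℝ (b (y, x₂, x₃, u)) ξ),
     lowPass α ψ (b (y, x₂, x₃, u)),
     (regressand k α y zy zf zb - inner ℝ ψ θ) • Matrix.toEuclideanLin Γ ψ)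

/-- The PEBO integrator state `ξ`. -/
def ObserverState.xi {n₂ n₃ n₄ : ℕ} : ObserverState n₂ n₃ n₄ → E n₄
  | (_, _, ξ, _, _, _, _, _) => ξ

/-- The parameter estimate `θ̂`. -/
def ObserverState.theta {n₂ n₃ n₄ : ℕ} : ObserverState n₂ n₃ n₄ → E n₄
  | (_, _, _, _, _, _, _, θ) => θ

/-- The observer output `x̂ = H(y, χ) = (y, x̂₂, x̂₃, ξ + θ̂)`. -/
noncomputable def observerOutput {n₁ n₂ n₃ n₄ : ℕ} :
    E n₁ → ObserverState n₂ n₃ n₄ → PlantState n₁ n₂ n₃ n₄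
  | y, (x₂, x₃, ξ, _, _, _, _, θ) => (y, x₂, x₃, ξ + θ)

end KKLPEB

/-! The argument follows the cascade and keeps every perturbation exponentially small. The error of
`x̂₂` solves an autonomous Hurwitz equation. The error of `x̂₃` solves a Hurwitz equation forced by
a difference of `f₃`, which decays because smooth maps are Lipschitz on the bounded region where the
signals live. Hence `x₄ - ξ` has an exponentially decaying, thus integrable, derivative and
converges to a constant `θ₀`: estimating the state `x₄` becomes estimating a parameter.

Filtering the equation of `y_k` gives `Ŷ = ⟨ψ̂, θ₀⟩ + r`, where `r` is the output of a stable filter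
with decaying input. The error `θ̃ = θ̂ - θ₀` then obeys `θ̃' = (r - e) Γψ̂` with `e = ⟨ψ̂, θ̃⟩`.
The function `θ̃ᵀ Γ⁻¹ θ̃` has derivative `2(r - e)e ≤ r² - e²`, so after adding the tail of an
exponential bound for `r²` it is nonincreasing. This bounds `θ̃`, and Barbalat's lemma yields `e →
0`, hence `θ̃' → 0`.

Excitation is assumed of the true regressor `b(t)`, not of `ψ̂`. Instead of showing that the filter
preserves excitation, Barbalat's lemma is applied a second time, to `e` itself: its derivative is
`α⟨b, θ̃⟩` up to vanishing terms, so `⟨b, θ̃⟩ → 0`. Since `θ̃` is asymptotically constant on windows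
of fixed length, excitation of `b` forces `θ̃ → 0`.

Global existence is separate and needs no boundedness: the observer is triangular, and each block is
linear in its own state with continuous coefficients. -/

namespace KKLPEB

/-! ### Calculus of exponentially decaying and bounded signals. -/

section Decay

variable {X Y Z : Type*} [NormedAddCommGroup X] [NormedAddCommGroup Y] [NormedAddCommGroup Z]

/-- A signal decays exponentially on `[0, ∞)`. -/
def ExpDecay (z : ℝ → X) : Prop :=
  ∃ C : ℝ, ∃ l > (0 : ℝ), ∀ t ∈ Ici (0 : ℝ), ‖z t‖ ≤ C * Real.exp (-(l * t))

theorem ExpDecay.of_norm_le {f : ℝ → X} {g : ℝ → Y} (hg : ExpDecay g) (K : ℝ)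
    (h : ∀ t ∈ Ici (0 : ℝ), ‖f t‖ ≤ K * ‖g t‖) : ExpDecay f := by
  obtain ⟨C, l, hl, hC⟩ := hg
  refine ⟨|K| * C, l, hl, fun t ht => (h t ht).trans ?_⟩
  calc K * ‖g t‖ ≤ |K| * ‖g t‖ := by gcongr; exact le_abs_self K
    _ ≤ |K| * (C * Real.exp (-(l * t))) := by gcongr; exact hC t ht
    _ = _ := by ring

theorem ExpDecay.congr {f g : ℝ → X} (hg : ExpDecay g)
    (h : ∀ t ∈ Ici (0 : ℝ), f t = g t) : ExpDecay f :=
  hg.of_norm_le 1 fun t ht => by rw [h t ht, one_mul]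

theorem ExpDecay.neg {f : ℝ → X} (hf : ExpDecay f) : ExpDecay fun t => -f t :=
  hf.of_norm_le 1 fun t _ => by rw [norm_neg, one_mul]

theorem ExpDecay.exists_pos {f : ℝ → X} (hf : ExpDecay f) :
    ∃ C > (0 : ℝ), ∃ l > (0 : ℝ), ∀ t ∈ Ici (0 : ℝ), ‖f t‖ ≤ C * Real.exp (-(l * t)) := by
  obtain ⟨C, l, hl, hC⟩ := hf
  exact ⟨|C| + 1, by positivity, l, hl, fun t ht => (hC t ht).trans (by
    gcongr; linarith [le_abs_self C])⟩

theorem ExpDecay.add {f g : ℝ → X} (hf : ExpDecay f) (hg : ExpDecay g) :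
    ExpDecay fun t => f t + g t := by
  obtain ⟨C, hC0, l, hl, hC⟩ := hf.exists_pos
  obtain ⟨D, hD0, k, hk, hD⟩ := hg.exists_pos
  refine ⟨C + D, min l k, lt_min hl hk, fun t ht => (norm_add_le _ _).trans ?_⟩
  rw [add_mul]
  have ht' : (0 : ℝ) ≤ t := ht
  refine add_le_add ((hC t ht).trans ?_) ((hD t ht).trans ?_)
  · gcongr; exact min_le_left _ _
  · gcongr; exact min_le_right _ _

theorem ExpDecay.tendsto {f : ℝ → X} (hf : ExpDecay f) : Tendsto f atTop (𝓝 0) := by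
  obtain ⟨C, l, hl, hC⟩ := hf
  refine squeeze_zero_norm' (a := fun t => C * Real.exp (-(l * t))) ?_ ?_
  · filter_upwards [eventually_ge_atTop 0] with t ht using hC t ht
  · have h := (Real.tendsto_exp_neg_atTop_nhds_zero.comp
      (tendsto_id.const_mul_atTop hl)).const_mul C
    simpa using h

theorem ExpDecay.bounded {f : ℝ → X} (hf : ExpDecay f) : IsBoundedSignal f := by
  obtain ⟨C, hC0, l, hl, hC⟩ := hf.exists_pos
  refine ⟨C, fun t ht => (hC t ht).trans ?_⟩
  have ht' : (0 : ℝ) ≤ t := ht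
  have : Real.exp (-(l * t)) ≤ 1 := Real.exp_le_one_iff.2 (by nlinarith)
  nlinarith

theorem IsBoundedSignal.exists_pos {f : ℝ → X} (hf : IsBoundedSignal f) :
    ∃ C > (0 : ℝ), ∀ t ∈ Ici (0 : ℝ), ‖f t‖ ≤ C := by
  obtain ⟨C, hC⟩ := hf
  exact ⟨|C| + 1, by positivity, fun t ht => (hC t ht).trans (by linarith [le_abs_self C])⟩

theorem IsBoundedSignal.add {f g : ℝ → X} (hf : IsBoundedSignal f) (hg : IsBoundedSignal g) :
    IsBoundedSignal fun t => f t + g t := by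
  obtain ⟨C, hC⟩ := hf
  obtain ⟨D, hD⟩ := hg
  exact ⟨C + D, fun t ht => (norm_add_le _ _).trans (add_le_add (hC t ht) (hD t ht))⟩

theorem IsBoundedSignal.neg {f : ℝ → X} (hf : IsBoundedSignal f) :
    IsBoundedSignal fun t => -f t := by
  obtain ⟨C, hC⟩ := hf
  exact ⟨C, fun t ht => by rw [norm_neg]; exact hC t ht⟩

theorem IsBoundedSignal.sub {f g : ℝ → X} (hf : IsBoundedSignal f) (hg : IsBoundedSignal g) :
    IsBoundedSignal fun t => f t - g t := by
  simpa only [sub_eq_add_neg] using hf.add hg.neg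

theorem IsBoundedSignal.congr {f g : ℝ → X} (hf : IsBoundedSignal f)
    (h : ∀ t ∈ Ici (0 : ℝ), g t = f t) : IsBoundedSignal g := by
  obtain ⟨C, hC⟩ := hf
  exact ⟨C, fun t ht => by rw [h t ht]; exact hC t ht⟩

theorem IsBoundedSignal.of_norm_le {f : ℝ → X} {g : ℝ → Y} (hg : IsBoundedSignal g)
    (h : ∀ t ∈ Ici (0 : ℝ), ‖f t‖ ≤ ‖g t‖) : IsBoundedSignal f := by
  obtain ⟨C, hC⟩ := hg
  exact ⟨C, fun t ht => (h t ht).trans (hC t ht)⟩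

theorem IsBoundedSignal.prodMk {f : ℝ → X} {g : ℝ → Y} (hf : IsBoundedSignal f)
    (hg : IsBoundedSignal g) : IsBoundedSignal fun t => (f t, g t) := by
  obtain ⟨C, hC⟩ := hf
  obtain ⟨D, hD⟩ := hg
  exact ⟨max C D, fun t ht => max_le_max (hC t ht) (hD t ht)⟩

theorem IsBoundedSignal.fst {f : ℝ → X × Y} (hf : IsBoundedSignal f) :
    IsBoundedSignal fun t => (f t).1 := hf.of_norm_le fun t _ => norm_fst_le (f t)

theorem IsBoundedSignal.snd {f : ℝ → X × Y} (hf : IsBoundedSignal f) :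
    IsBoundedSignal fun t => (f t).2 := hf.of_norm_le fun t _ => norm_snd_le (f t)

theorem ExpDecay.prodMk {f : ℝ → X} {g : ℝ → Y} (hf : ExpDecay f) (hg : ExpDecay g) :
    ExpDecay fun t => (f t, g t) := by
  refine ((hf.of_norm_le (f := fun t => ‖f t‖) 1 fun t _ => by simp).add
    (hg.of_norm_le (f := fun t => ‖g t‖) 1 fun t _ => by simp)).of_norm_le 1 fun t _ => ?_
  rw [one_mul, Real.norm_of_nonneg (by positivity)]
  exact max_le (by simp) (by simp)

/-- Continuous images of bounded signals are bounded. -/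
theorem IsBoundedSignal.comp_continuous [ProperSpace X] {F : X → Y} (hF : Continuous F)
    {p : ℝ → X} (hp : IsBoundedSignal p) : IsBoundedSignal fun t => F (p t) := by
  obtain ⟨R, hR⟩ := hp
  obtain ⟨C, hC⟩ := (isCompact_closedBall (0 : X) R).exists_bound_of_continuousOn hF.continuousOn
  exact ⟨C, fun t ht => hC _ (by simpa using hR t ht)⟩

/-- A continuous image of a bounded uniformly continuous signal is uniformly continuous. -/
theorem IsBoundedSignal.uniformContinuousOn_comp [ProperSpace X] {F : X → Y} (hF : Continuous F)
    {p : ℝ → X} (hp : IsBoundedSignal p) (hu : UniformContinuousOn p (Ici 0)) :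
    UniformContinuousOn (fun t => F (p t)) (Ici 0) := by
  obtain ⟨R, hR⟩ := hp
  exact ((isCompact_closedBall (0 : X) R).uniformContinuousOn_of_continuous hF.continuousOn).comp hu
    fun t ht => by simpa using hR t ht

theorem uniformContinuousOn_prodMk {s : Set ℝ} {f : ℝ → X} {g : ℝ → Y}
    (hf : UniformContinuousOn f s) (hg : UniformContinuousOn g s) :
    UniformContinuousOn (fun t => (f t, g t)) s := by
  rw [uniformContinuousOn_iff_restrict] at *
  exact hf.prodMk hg

/-- A smooth map evaluated along two bounded signals whose difference decays. -/
theorem ExpDecay.comp_contDiff [NormedSpace ℝ X] [NormedSpace ℝ Y] [ProperSpace X]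
    {F : X → Y} (hF : ContDiff ℝ ∞ F) {p q : ℝ → X}
    (hp : IsBoundedSignal p) (hq : IsBoundedSignal q) (h : ExpDecay fun t => p t - q t) :
    ExpDecay fun t => F (p t) - F (q t) := by
  obtain ⟨R, hR⟩ := hp
  obtain ⟨S, hS⟩ := hq
  -- Both signals stay in one compact ball, where a `C¹` map has a single Lipschitz constant.
  obtain ⟨K, hK⟩ := (hF.of_le (n := ∞) (m := 1) (by norm_cast)).locallyLipschitz
    |>.locallyLipschitzOn (s := Metric.closedBall (0 : X) (max R S))
    |>.exists_lipschitzOnWith_of_compact (isCompact_closedBall _ _)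
  refine h.of_norm_le K fun t ht => ?_
  exact hK.norm_sub_le (by simpa using Or.inl (hR t ht)) (by simpa using Or.inr (hS t ht))

end Decay

/-! ### Scalar and first-order linear equations with decaying or bounded forcing. -/

section Scalar

variable {X : Type*} [NormedAddCommGroup X] [NormedSpace ℝ X]

/-- Comparison estimate for a signal `z` in terms of the rescaled signal `y = e^{at} z`. -/
theorem norm_le_of_rescaled {W : Type*} [NormedAddCommGroup W] {z : ℝ → W} {y y' : ℝ → X}
    {a c C : ℝ} (hca : c < a) (hC : 0 ≤ C)
    (hy : ∀ t ∈ Ici (0 : ℝ), HasDerivWithinAt y (y' t) (Ici 0) t)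
    (hyz : ∀ t, ‖y t‖ = Real.exp (a * t) * ‖z t‖)
    (hy' : ∀ t ∈ Ici (0 : ℝ), ‖y' t‖ ≤ C * Real.exp ((a - c) * t)) :
    ∀ t ∈ Ici (0 : ℝ), ‖z t‖ ≤ (‖z 0‖ + C / (a - c)) * Real.exp (-(c * t)) := by
  intro t ht
  have ht' : (0 : ℝ) ≤ t := ht
  have hac : 0 < a - c := sub_pos.2 hca
  -- The comparison function integrates the bound on `y'`; the negative constant of integration is
  -- dropped.
  have hB : ∀ s : ℝ, HasDerivAt (fun s => ‖z 0‖ + C / (a - c) * Real.exp ((a - c) * s))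
      (C * Real.exp ((a - c) * s)) s := by
    intro s
    have h := ((((hasDerivAt_id s).const_mul (a - c)).exp).const_mul (C / (a - c))).const_add ‖z 0‖
    refine h.congr_deriv ?_
    simp only [id]
    field_simp
  have h1 := image_norm_le_of_norm_deriv_right_le_deriv_boundary (a := 0) (b := t) (f := y)
    (f' := y')
    (fun s hs => ((hy s hs.1).mono (fun r hr => hr.1)).continuousWithinAt)
    (fun s hs => (hy s hs.1).mono (Ici_subset_Ici.2 hs.1)) (B := _) (B' := _)
    (by rw [hyz 0]; simp; positivity) hB (fun s hs => hy' s hs.1) (right_mem_Icc.2 ht')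
  rw [hyz t] at h1
  have h2 : ‖z t‖ = Real.exp (-(a * t)) * (Real.exp (a * t) * ‖z t‖) := by
    rw [← mul_assoc, ← Real.exp_add]; simp
  rw [h2]
  calc _ ≤ Real.exp (-(a * t)) * (‖z 0‖ + C / (a - c) * Real.exp ((a - c) * t)) := by gcongr
    _ = ‖z 0‖ * Real.exp (-(a * t)) + C / (a - c) * (Real.exp (-(a * t)) *
        Real.exp ((a - c) * t)) := by ring
    _ = ‖z 0‖ * Real.exp (-(a * t)) + C / (a - c) * Real.exp (-(c * t)) := by
        rw [← Real.exp_add]; congr 3; ring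
    _ ≤ ‖z 0‖ * Real.exp (-(c * t)) + C / (a - c) * Real.exp (-(c * t)) := by gcongr
    _ = _ := by ring

theorem norm_lowPass_le {z g : ℝ → X} {a c C : ℝ} (hca : c < a) (hC : 0 ≤ C)
    (hz : ∀ t ∈ Ici (0 : ℝ), HasDerivWithinAt z (-(a • z t) + g t) (Ici 0) t)
    (hg : ∀ t ∈ Ici (0 : ℝ), ‖g t‖ ≤ C * Real.exp (-(c * t))) :
    ∀ t ∈ Ici (0 : ℝ), ‖z t‖ ≤ (‖z 0‖ + C / (a - c)) * Real.exp (-(c * t)) := by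
  refine norm_le_of_rescaled (y := fun t => Real.exp (a * t) • z t)
    (y' := fun t => Real.exp (a * t) • g t) hca hC (fun t ht => ?_) (fun t => ?_) (fun t ht => ?_)
  · have h := (((hasDerivAt_id t).const_mul a).exp.hasDerivWithinAt (s := Ici 0)).smul (hz t ht)
    refine h.congr_deriv ?_
    simp only [id]
    module
  · rw [norm_smul, Real.norm_of_nonneg (Real.exp_pos _).le]
  · rw [norm_smul, Real.norm_of_nonneg (Real.exp_pos _).le]
    calc _ ≤ Real.exp (a * t) * (C * Real.exp (-(c * t))) := by gcongr; exact hg t ht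
      _ = C * (Real.exp (a * t) * Real.exp (-(c * t))) := by ring
      _ = _ := by rw [← Real.exp_add]; congr 2; ring

/-- First-order filters map decaying signals to decaying signals. -/
theorem ExpDecay.filter {z g : ℝ → X} {a : ℝ} (ha : 0 < a)
    (hz : ∀ t ∈ Ici (0 : ℝ), HasDerivWithinAt z (-(a • z t) + g t) (Ici 0) t)
    (hg : ExpDecay g) : ExpDecay z := by
  obtain ⟨C, hC0, l, hl, hC⟩ := hg.exists_pos
  -- Halving `a` keeps the rate strictly below that of the filter, which excludes the resonant case
  -- `l = a`.
  have hm : 0 < min l (a / 2) := by positivity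
  refine ⟨_, min l (a / 2), hm, norm_lowPass_le (C := C) ?_ hC0.le hz fun t ht => ?_⟩
  · exact (min_le_right _ _).trans_lt (by linarith)
  · refine (hC t ht).trans ?_
    have ht' : (0 : ℝ) ≤ t := ht
    gcongr
    exact min_le_left _ _

/-- First-order filters map bounded signals to bounded signals. -/
theorem IsBoundedSignal.filter {z g : ℝ → X} {a : ℝ} (ha : 0 < a)
    (hz : ∀ t ∈ Ici (0 : ℝ), HasDerivWithinAt z (-(a • z t) + g t) (Ici 0) t)
    (hg : IsBoundedSignal g) : IsBoundedSignal z := by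
  obtain ⟨C, hC0, hC⟩ := hg.exists_pos
  refine ⟨_, fun t ht => (norm_lowPass_le (c := 0) ha hC0.le hz (fun t ht => ?_) t ht).trans
    (by simp only [zero_mul, neg_zero, Real.exp_zero, mul_one]; exact le_rfl)⟩
  simpa using hC t ht

/-- Multiplication by `e^{-μt}`, of modulus `e^{-t Re μ}`, removes the linear term. A complex `μ`
acting on vectors is what peeling off eigenvalues one at a time requires. -/
theorem ExpDecay.scalar [NormedSpace ℂ X] [IsScalarTower ℝ ℂ X] {z g : ℝ → X} {μ : ℂ}
    (hμ : μ.re < 0)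
    (hz : ∀ t ∈ Ici (0 : ℝ), HasDerivWithinAt z (μ • z t + g t) (Ici 0) t)
    (hg : ExpDecay g) : ExpDecay z := by
  obtain ⟨C, hC0, l, hl, hC⟩ := hg.exists_pos
  have hm : 0 < min l (-μ.re / 2) := lt_min hl (by linarith)
  have hexp : ∀ t : ℝ, ‖Complex.exp (-μ * t)‖ = Real.exp (-μ.re * t) := fun t => by
    rw [Complex.norm_exp]; simp
  refine ⟨_, min l (-μ.re / 2), hm, norm_le_of_rescaled (C := C) (a := -μ.re)
    (y := fun t => Complex.exp (-μ * t) • z t) (y' := fun t => Complex.exp (-μ * t) • g t)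
    ?_ hC0.le (fun t ht => ?_) (fun t => ?_) fun t ht => ?_⟩
  · exact (min_le_right _ _).trans_lt (by linarith)
  · have h1 : HasDerivAt (fun t : ℝ => Complex.exp (-μ * t)) (Complex.exp (-μ * t) * -μ) t := by
      have := ((Complex.ofRealCLM.hasDerivAt (x := t)).const_mul (-μ)).cexp
      simpa using this
    refine (h1.hasDerivWithinAt.smul (hz t ht)).congr_deriv ?_
    module
  · rw [norm_smul, hexp]
  · rw [norm_smul, hexp]
    have ht' : (0 : ℝ) ≤ t := ht
    calc _ ≤ Real.exp (-μ.re * t) * (C * Real.exp (-(min l (-μ.re / 2) * t))) := by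
          gcongr
          refine (hC t ht).trans ?_
          gcongr
          exact min_le_left _ _
      _ = C * (Real.exp (-μ.re * t) * Real.exp (-(min l (-μ.re / 2) * t))) := by ring
      _ = _ := by rw [← Real.exp_add]; congr 2; ring

end Scalar

/-! ### Stability of Hurwitz systems through the characteristic polynomial. -/

section Hurwitz

open Polynomial

/-- If the polynomial with stable roots `s` annihilates `z`, and `ż = M z + g` with `g` decaying,
then `z` decays. -/
theorem ExpDecay.of_annihilated {V : Type*} [NormedAddCommGroup V] [NormedSpace ℂ V]
    (M : V →L[ℂ] V) (s : Multiset ℂ) (hs : ∀ μ ∈ s, μ.re < 0) :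
    ∀ z g : ℝ → V,
      (∀ t ∈ Ici (0 : ℝ), HasDerivWithinAt z (M (z t) + g t) (Ici 0) t) → ExpDecay g →
      (∀ t, aeval M (s.map fun μ => X - C μ).prod (z t) = 0) → ExpDecay z := by
  induction s using Multiset.induction with
  | empty =>
    intro z g _ _ h
    exact ⟨0, 1, one_pos, fun t _ => by have := h t; simp at this; simp [this]⟩
  | cons μ s ih =>
    intro z g hz hg h
    have hN : ∀ f : ℝ → V, ExpDecay f → ExpDecay fun t => (M - μ • 1) (f t) := fun f hf =>
      hf.of_norm_le ‖M - μ • 1‖ fun t _ => (M - μ • 1).le_opNorm _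
    -- Since `M` commutes with `M - μ`, the signal `w = (M - μ)z` solves the same kind of equation
    -- and is annihilated by the remaining factors. Afterwards `ż = μz + (w + g)` is scalar.
    have hw : ExpDecay fun t => (M - μ • 1) (z t) := by
      refine ih (fun ν hν => hs ν (Multiset.mem_cons_of_mem hν)) _ (fun t => (M - μ • 1) (g t))
        (fun t ht => ?_) (hN g hg) (fun t => ?_)
      · have := (((M - μ • 1).restrictScalars ℝ).hasFDerivAt.comp_hasDerivWithinAt t (hz t ht))
        refine this.congr_deriv ?_
        simp
        abel
      · have := h t
        rw [Multiset.map_cons, Multiset.prod_cons, mul_comm, map_mul] at this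
        have h2 : aeval M (X - C μ) = M - μ • 1 := by
          simp [Algebra.algebraMap_eq_smul_one]
        rw [h2] at this
        exact this
    refine ExpDecay.scalar (μ := μ) (hs μ (Multiset.mem_cons_self μ s)) (fun t ht => ?_) (hw.add hg)
    refine (hz t ht).congr_deriv ?_
    simp
    abel

/-- Over `ℂ` the characteristic polynomial splits with roots in the spectrum, and by Cayley–Hamilton
it annihilates every signal. Neither a Jordan form nor a matrix exponential is needed. -/
theorem IsHurwitz.expDecay {n : ℕ} {A : Matrix (Fin n) (Fin n) ℝ} (hA : IsHurwitz A)
    {z g : ℝ → E n}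
    (hz : ∀ t ∈ Ici (0 : ℝ), HasDerivWithinAt z (Matrix.toEuclideanLin A (z t) + g t) (Ici 0) t)
    (hg : ExpDecay g) : ExpDecay z := by
  set Ac : Matrix (Fin n) (Fin n) ℂ := A.map (algebraMap ℝ ℂ) with hAc
  let M : (Fin n → ℂ) →L[ℂ] (Fin n → ℂ) := LinearMap.toContinuousLinearMap (Matrix.toLin' Ac)
  let cplx : E n → (Fin n → ℂ) := fun v i => (v i : ℂ)
  have hle : ∀ v : E n, ‖cplx v‖ ≤ ‖v‖ := fun v => by
    refine (pi_norm_le_iff_of_nonneg (norm_nonneg _)).2 fun i => ?_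
    simpa [cplx] using PiLp.norm_apply_le v i
  have key : ExpDecay fun t => cplx (z t) := by
    refine ExpDecay.of_annihilated M Ac.charpoly.roots (fun μ hμ => ?_) _ (fun t => cplx (g t))
      (fun t ht => ?_) (hg.of_norm_le 1 fun t _ => by simpa using hle (g t)) (fun t => ?_)
    · exact hA μ (Matrix.mem_spectrum_of_isRoot_charpoly (isRoot_of_mem_roots hμ))
    · rw [hasDerivWithinAt_pi]
      intro i
      have h1 := (EuclideanSpace.proj (𝕜 := ℝ) i).hasFDerivAt.comp_hasDerivWithinAt t (hz t ht)
      have h2 := Complex.ofRealCLM.hasFDerivAt.comp_hasDerivWithinAt t h1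
      refine h2.congr_deriv ?_
      simp [M, cplx, Matrix.mulVec, dotProduct, hAc]
    · have hsp := IsAlgClosed.splits Ac.charpoly
      have hprod := hsp.eq_prod_roots_of_monic (Matrix.charpoly_monic Ac)
      rw [← hprod]
      have h0 : aeval M Ac.charpoly = 0 := by
        have h1 : aeval (Matrix.toLin' Ac) Ac.charpoly = 0 := by
          have := congrArg (Matrix.toLinAlgEquiv' : Matrix (Fin n) (Fin n) ℂ ≃ₐ[ℂ] _)
            (Matrix.aeval_self_charpoly Ac)
          rw [← aeval_algHom_apply, map_zero] at this
          exact this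
        have := congrArg (Module.End.toContinuousLinearMap (Fin n → ℂ)) h1
        rw [← aeval_algHom_apply, map_zero] at this
        exact this
      rw [h0]; rfl
  -- The factor `n` compares the Euclidean norm with the sup norm of the complexification, through
  -- the sum of the coordinates.
  refine key.of_norm_le (n : ℝ) fun t _ => ?_
  calc ‖z t‖ ≤ ∑ i, ‖z t i‖ := by
        rw [EuclideanSpace.norm_eq]
        refine Real.sqrt_le_iff.2 ⟨by positivity, ?_⟩
        exact Finset.sum_sq_le_sq_sum_of_nonneg fun i _ => norm_nonneg _
    _ ≤ ∑ i : Fin n, ‖cplx (z t)‖ := by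
        refine Finset.sum_le_sum fun i _ => ?_
        simpa [cplx] using norm_le_pi_norm (cplx (z t)) i
    _ = _ := by simp

end Hurwitz

end KKLPEB

namespace KKLPEB

/-! ### Global solutions of linear time-varying equations. -/

section Existence

open scoped NNReal

variable {X : Type*} [NormedAddCommGroup X] [NormedSpace ℝ X] [FiniteDimensional ℝ X]

/-- A smooth radial truncation: identity on a ball, bounded, Lipschitz and norm-nonincreasing. -/
theorem exists_truncation (R : ℝ) (hR : 0 < R) :
    ∃ φ : X → X, (∀ x, ‖x‖ ≤ R → φ x = x) ∧ (∀ x, ‖φ x‖ ≤ ‖x‖) ∧ (∀ x, ‖φ x‖ ≤ R + 1) ∧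
      ∃ K, LipschitzWith K φ := by
  let β : ContDiffBump (0 : X) := ⟨R, R + 1, hR, by linarith⟩
  have hle : ∀ x, ‖β x • x‖ ≤ ‖x‖ := fun x => by
    rw [norm_smul, Real.norm_of_nonneg β.nonneg]
    exact mul_le_of_le_one_left (norm_nonneg _) β.le_one
  refine ⟨fun x => β x • x, fun x hx => ?_, hle, fun x => ?_, ?_⟩
  · have : β x = 1 := β.one_of_mem_closedBall (by simpa using hx)
    simp [this]
  · by_cases hx : ‖x‖ ≤ R + 1
    · exact (hle x).trans hx
    · have : β x = 0 := β.zero_of_le_dist (by simpa using (not_le.1 hx).le)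
      simp only [this, zero_smul, norm_zero]
      linarith
  · refine ContDiff.lipschitzWith_of_hasCompactSupport (𝕂 := ℝ) (n := 1) ?_ ?_ one_ne_zero
    · exact β.hasCompactSupport.smul_right
    · exact β.contDiff.smul contDiff_id

/-- Existence for linear time-varying equations on a compact interval. -/
theorem exists_linear_Icc {A : ℝ → X →L[ℝ] X} {g : ℝ → X} {T : ℝ} (hT : 0 ≤ T)
    (hA : ContinuousOn A (Icc 0 T)) (hg : ContinuousOn g (Icc 0 T)) (z₀ : X) :
    ∃ z : ℝ → X, z 0 = z₀ ∧
      ∀ t ∈ Icc 0 T, HasDerivWithinAt z (A t (z t) + g t) (Icc 0 T) t := by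
  obtain ⟨M, hM⟩ := isCompact_Icc.exists_bound_of_continuousOn hA
  obtain ⟨G, hG⟩ := isCompact_Icc.exists_bound_of_continuousOn hg
  have h0 : (0 : ℝ) ∈ Icc 0 T := left_mem_Icc.2 hT
  have hM0 : 0 ≤ M := (norm_nonneg _).trans (hM 0 h0)
  have hG0 : 0 ≤ G := (norm_nonneg _).trans (hG 0 h0)
  have hmono := gronwallBound_mono (norm_nonneg z₀) hG0 hM0
  set R := gronwallBound ‖z₀‖ M G T with hRdef
  have hR0 : 0 ≤ R := (norm_nonneg z₀).trans (by
    have := hmono hT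
    rwa [gronwallBound_x0] at this)
  -- `R` is the a priori Grönwall bound. Truncating beyond it makes the field globally bounded and
  -- Lipschitz, so Picard–Lindelöf covers the whole interval in one step; the extra `1` makes the
  -- radius positive.
  obtain ⟨φ, hφ1, hφ2, hφ3, K, hφ4⟩ := exists_truncation (X := X) (R + 1) (by linarith)
  let f : ℝ → X → X := fun t x => A t (φ x) + g t
  have hL0 : 0 ≤ M * (R + 1 + 1) + G := by positivity
  obtain ⟨L, hL⟩ : ∃ L : ℝ≥0, (L : ℝ) = M * (R + 1 + 1) + G := ⟨⟨_, hL0⟩, rfl⟩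
  obtain ⟨T', hT'⟩ : ∃ T' : ℝ≥0, (T' : ℝ) = T := ⟨⟨_, hT⟩, rfl⟩
  obtain ⟨M', hM'⟩ : ∃ M' : ℝ≥0, (M' : ℝ) = M := ⟨⟨_, hM0⟩, rfl⟩
  have hP : IsPicardLindelof f (tmin := 0) (tmax := T) ⟨0, h0⟩ z₀ (L * T') 0 L (M' * K) := by
    refine ⟨fun t ht => ?_, fun x _ => ?_, fun t ht x _ => ?_, ?_⟩
    · refine LipschitzOnWith.of_dist_le_mul fun x _ y _ => ?_
      simp only [f, dist_eq_norm, add_sub_add_right_eq_sub, ← map_sub]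
      refine ((A t).le_opNorm _).trans ?_
      rw [NNReal.coe_mul, hM', mul_assoc]
      refine mul_le_mul (hM t ht) ?_ (norm_nonneg _) hM0
      simpa [dist_eq_norm] using hφ4.dist_le_mul x y
    · exact (hA.clm_apply continuousOn_const).add hg
    · rw [hL]
      refine (norm_add_le _ _).trans (add_le_add (((A t).le_opNorm _).trans ?_) (hG t ht))
      exact mul_le_mul (hM t ht) (hφ3 x) (norm_nonneg _) hM0
    · simp [hT, hT']
  obtain ⟨z, hz0, hz⟩ := hP.exists_eq_forall_mem_Icc_hasDerivWithinAt₀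
  have hz0 : z 0 = z₀ := hz0
  refine ⟨z, hz0, fun t ht => ?_⟩
  -- Because `‖φ x‖ ≤ ‖x‖`, the truncated solution satisfies the same growth inequality as the
  -- linear one. It therefore never leaves the ball where `φ` is the identity.
  have hb := norm_le_gronwallBound_of_norm_deriv_right_le (f := z) (f' := fun t => f t (z t))
    (δ := ‖z₀‖) (K := M) (ε := G) (a := 0) (b := T)
    (fun s hs => (hz s hs).continuousWithinAt)
    (fun s hs => (hz s ⟨hs.1, hs.2.le⟩).mono_of_mem_nhdsWithin (Icc_mem_nhdsGE_of_mem hs))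
    (by rw [hz0]) (fun s hs => by
      refine (norm_add_le _ _).trans (add_le_add (((A s).le_opNorm _).trans ?_)
        (hG s ⟨hs.1, hs.2.le⟩))
      exact mul_le_mul (hM s ⟨hs.1, hs.2.le⟩) (hφ2 _) (norm_nonneg _) hM0) t ht
  have hzt : ‖z t‖ ≤ R + 1 := by
    refine hb.trans ((hmono (sub_le_self t le_rfl)).trans ?_)
    have := hmono ht.2
    linarith
  have := hz t ht
  simpa only [f, hφ1 _ hzt] using this

/-- Global existence for linear time-varying equations on `[0, ∞)`. -/
theorem exists_linear {A : ℝ → X →L[ℝ] X} {g : ℝ → X}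
    (hA : ContinuousOn A (Ici 0)) (hg : ContinuousOn g (Ici 0)) (z₀ : X) :
    ∃ z : ℝ → X, z 0 = z₀ ∧
      ∀ t ∈ Ici (0 : ℝ), HasDerivWithinAt z (A t (z t) + g t) (Ici 0) t := by
  choose z hz0 hz using fun n : ℕ => exists_linear_Icc (T := (n : ℝ)) n.cast_nonneg
    (hA.mono Icc_subset_Ici_self) (hg.mono Icc_subset_Ici_self) z₀
  have huniq : ∀ n m : ℕ, n ≤ m → EqOn (z n) (z m) (Icc 0 n) := by
    intro n m hnm t ht
    obtain ⟨M, hM⟩ := (isCompact_Icc (a := (0 : ℝ)) (b := n)).exists_bound_of_continuousOn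
      (hA.mono Icc_subset_Ici_self)
    have hnm' : (n : ℝ) ≤ m := by exact_mod_cast hnm
    have hsub : Icc (0 : ℝ) n ⊆ Icc 0 m := Icc_subset_Icc_right hnm'
    refine sub_eq_zero.1 (eq_zero_of_abs_deriv_le_mul_abs_self_of_eq_zero_right
      (f := fun t => z n t - z m t) (f' := fun t => A t (z n t - z m t)) (K := M)
      (a := 0) (b := n) ?_ ?_ ?_ ?_ t ht)
    · exact fun s hs => ((hz n s hs).continuousWithinAt).sub
        ((hz m s (hsub hs)).continuousWithinAt.mono hsub)
    · intro s hs
      have h1 := (hz n s ⟨hs.1, hs.2.le⟩).mono_of_mem_nhdsWithin (Icc_mem_nhdsGE_of_mem hs)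
      have h2 := (hz m s ⟨hs.1, hs.2.le.trans hnm'⟩).mono_of_mem_nhdsWithin
        (Icc_mem_nhdsGE_of_mem ⟨hs.1, hs.2.trans_le hnm'⟩)
      refine (h1.sub h2).congr_deriv ?_
      rw [map_sub]; abel
    · rw [hz0, hz0, sub_self]
    · intro s hs
      refine ((A s).le_opNorm _).trans ?_
      gcongr
      exact hM s ⟨hs.1, hs.2.le⟩
  -- The strict inequality puts `t` below the right endpoint, so the chosen piece describes the
  -- glued solution on a neighbourhood of `t` in `[0, ∞)`.
  have hex : ∀ t : ℝ, t < (⌊t⌋₊ + 1 : ℕ) := fun t => by exact_mod_cast Nat.lt_floor_add_one t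
  have heq : ∀ n : ℕ, ∀ t ∈ Icc (0 : ℝ) n, z (⌊t⌋₊ + 1) t = z n t := by
    intro n t ht
    rcases le_total n (⌊t⌋₊ + 1) with h | h
    · exact (huniq n _ h ht).symm
    · exact huniq _ n h ⟨ht.1, (hex t).le⟩
  refine ⟨fun t => z (⌊t⌋₊ + 1) t, by simp only [hz0], fun t ht => ?_⟩
  set n := ⌊t⌋₊ + 1 with hn
  have htn : t ∈ Icc (0 : ℝ) n := ⟨ht, (hex t).le⟩
  have hnhds : Icc (0 : ℝ) n ∈ 𝓝[Ici 0] t := by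
    rw [← Ici_inter_Iic]
    exact inter_mem self_mem_nhdsWithin (mem_nhdsWithin_of_mem_nhds (Iic_mem_nhds (hex t)))
  exact ((hz n t htn).congr (fun s hs => heq n s hs) (heq n t htn)).mono_of_mem_nhdsWithin hnhds

end Existence

end KKLPEB

namespace KKLPEB

/-! ### Barbalat's lemma and monotone convergence. -/

section Barbalat

/-- A signal with bounded derivative on `[0, ∞)` is uniformly continuous there. -/
theorem uniformContinuousOn_of_deriv_bounded {X : Type*} [NormedAddCommGroup X] [NormedSpace ℝ X]
    {f f' : ℝ → X} (hf : ∀ t ∈ Ici (0 : ℝ), HasDerivWithinAt f (f' t) (Ici 0) t)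
    (hb : IsBoundedSignal f') : UniformContinuousOn f (Ici 0) := by
  obtain ⟨C, hC0, hC⟩ := hb.exists_pos
  exact ((convex_Ici 0).lipschitzOnWith_of_nnnorm_hasDerivWithin_le (C := ⟨C, hC0.le⟩) hf
    fun t ht => hC t ht).uniformContinuousOn

/-- **Barbalat's lemma**, with a vanishing perturbation of the derivative. -/
theorem barbalat {F F' φ : ℝ → ℝ} {l : ℝ}
    (hF : ∀ t ∈ Ici (0 : ℝ), HasDerivWithinAt F (F' t) (Ici 0) t)
    (hlim : Tendsto F atTop (𝓝 l)) (hφ : UniformContinuousOn φ (Ici 0))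
    (hF' : Tendsto (fun t => F' t - φ t) atTop (𝓝 0)) : Tendsto φ atTop (𝓝 0) := by
  rw [Metric.tendsto_atTop] at *
  intro ε hε
  obtain ⟨d, hd, hu⟩ := Metric.uniformContinuousOn_iff.1 hφ (ε / 4) (by positivity)
  obtain ⟨N₁, hN₁⟩ := hF' (ε / 4) (by positivity)
  obtain ⟨N₂, hN₂⟩ := hlim (ε * (d / 2) / 4) (by positivity)
  refine ⟨max 0 (max N₁ N₂), fun t ht => ?_⟩
  have ht0 : 0 ≤ t := (le_max_left _ _).trans ht
  have ht1 : N₁ ≤ t := ((le_max_left _ _).trans (le_max_right _ _)).trans ht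
  have ht2 : N₂ ≤ t := ((le_max_right _ _).trans (le_max_right _ _)).trans ht
  set h := d / 2 with hh
  have hh0 : 0 < h := by positivity
  -- Freezing `φ` at `t`, the increment of `F` over `[t, t + h]` differs from `φ t * h` by at most
  -- `εh/2`. Convergence of `F` makes that increment smaller than `εh/2`.
  have hmv := (convex_Icc t (t + h)).norm_image_sub_le_of_norm_hasDerivWithin_le
    (f := fun s => F s - φ t * s) (f' := fun s => F' s - φ t) (C := ε / 2)
    (fun s hs => by
      have h1 := ((hF s (ht0.trans hs.1)).mono (fun r hr => ht0.trans hr.1 : Icc t (t + h) ⊆ Ici 0))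
      have h2 := ((hasDerivAt_id s).const_mul (φ t)).hasDerivWithinAt (s := Icc t (t + h))
      exact (h1.sub h2).congr_deriv (by simp))
    (fun s hs => by
      have h1 := hN₁ s (ht1.trans hs.1)
      have h2 := hu s (ht0.trans hs.1) t ht0 (by
        rw [Real.dist_eq, abs_of_nonneg (by linarith [hs.1])]; linarith [hs.2])
      rw [Real.dist_eq] at h1 h2
      rw [sub_zero] at h1
      rw [Real.norm_eq_abs]
      calc |F' s - φ t| = |(F' s - φ s) + (φ s - φ t)| := by ring_nf
        _ ≤ _ := abs_add_le _ _
        _ ≤ ε / 2 := by linarith)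
    (left_mem_Icc.2 (by linarith)) (right_mem_Icc.2 (by linarith))
  have hF1 := hN₂ t ht2
  have hF2 := hN₂ (t + h) (by linarith)
  rw [Real.dist_eq] at *
  rw [Real.norm_eq_abs, Real.norm_eq_abs, add_sub_cancel_left, abs_of_pos hh0] at hmv
  rw [sub_zero]
  rw [abs_lt] at hF1 hF2
  rw [abs_le] at hmv
  have h3 : |φ t| * h < ε * h := by
    rw [← abs_of_pos hh0, ← abs_mul, abs_of_pos hh0, abs_lt]
    constructor <;> nlinarith
  exact lt_of_mul_lt_mul_right h3 hh0.le

/-- A nonnegative antitone signal on `[0, ∞)` converges. -/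
theorem exists_tendsto_of_antitoneOn {W : ℝ → ℝ} (hW : AntitoneOn W (Ici 0))
    (h0 : ∀ t ∈ Ici (0 : ℝ), 0 ≤ W t) : ∃ l, Tendsto W atTop (𝓝 l) := by
  have ha : Antitone fun t => W (max t 0) := fun s t hst =>
    hW (mem_Ici.2 (le_max_right _ _)) (mem_Ici.2 (le_max_right _ _)) (max_le_max_right _ hst)
  refine ⟨_, (tendsto_atTop_ciInf ha ⟨0, ?_⟩).congr' ?_⟩
  · rintro _ ⟨t, rfl⟩
    exact h0 _ (mem_Ici.2 (le_max_right _ _))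
  · filter_upwards [eventually_ge_atTop 0] with t ht
    rw [max_eq_left ht]

end Barbalat

/-! ### Consequences of persistency of excitation. -/

section Excitation

/-- The quadratic form of the Gram matrix at `v` is the integral of `⟨w, v⟩²`; continuity of `w`
justifies exchanging the finite sums with the integral. -/
theorem IsPersistentlyExciting.le_integral {n : ℕ} {w : ℝ → E n}
    (hw : ContinuousOn w (Ici 0)) (h : IsPersistentlyExciting w) :
    ∃ T > (0 : ℝ), ∃ δ > (0 : ℝ), ∀ t ≥ (0 : ℝ), ∀ v : E n,
      δ * ‖v‖ ^ 2 ≤ ∫ s in t..(t + T), (inner ℝ (w s) v) ^ 2 := by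
  obtain ⟨T, hT, δ, hδ, hp⟩ := h
  refine ⟨T, hT, δ, hδ, fun t ht v => ?_⟩
  have hsub : uIcc t (t + T) ⊆ Ici 0 := by
    rw [uIcc_of_le (by linarith)]
    exact fun s hs => ht.trans hs.1
  have hc : ∀ i, ContinuousOn (fun s => w s i) (uIcc t (t + T)) := fun i =>
    (EuclideanSpace.proj (𝕜 := ℝ) i).continuous.comp_continuousOn (hw.mono hsub)
  have h1 := (hp t ht).dotProduct_mulVec_nonneg (v : Fin n → ℝ)
  rw [Matrix.sub_mulVec, dotProduct_sub, Matrix.smul_mulVec, Matrix.one_mulVec, dotProduct_smul,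
    sub_nonneg] at h1
  have h2 : star (v : Fin n → ℝ) ⬝ᵥ (v : Fin n → ℝ) = ‖v‖ ^ 2 := by
    rw [EuclideanSpace.norm_sq_eq]
    simp [dotProduct, sq]
  rw [h2, smul_eq_mul] at h1
  refine h1.trans_eq ?_
  have h3 : ∀ s, (inner ℝ (w s) v) ^ 2 = ∑ i, ∑ j, v i * v j * (w s i * w s j) := by
    intro s
    simp only [PiLp.inner_apply, RCLike.inner_apply, conj_trivial, sq, Finset.sum_mul_sum]
    exact Finset.sum_congr rfl fun i _ => Finset.sum_congr rfl fun j _ => by ring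
  simp only [h3]
  rw [intervalIntegral.integral_finsetSum]
  · simp only [dotProduct, Matrix.mulVec, Finset.mul_sum, Matrix.of_apply]
    refine Finset.sum_congr rfl fun i _ => ?_
    rw [intervalIntegral.integral_finsetSum]
    · refine Finset.sum_congr rfl fun j _ => ?_
      rw [intervalIntegral.integral_const_mul]
      simp
      ring
    · exact fun j _ => (continuousOn_const.mul ((hc i).mul (hc j))).intervalIntegrable
  · exact fun i _ => (continuousOn_finsetSum _ fun j _ =>
      continuousOn_const.mul ((hc i).mul (hc j))).intervalIntegrable

/-- If `⟨w, θ⟩ → 0` and `θ̇ → 0` for a bounded, persistently exciting `w`, then `θ → 0`. -/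
theorem IsPersistentlyExciting.tendsto_zero {n : ℕ} {w θ θ' : ℝ → E n}
    (hw : ContinuousOn w (Ici 0)) (hwb : IsBoundedSignal w) (h : IsPersistentlyExciting w)
    (hθ : ∀ t ∈ Ici (0 : ℝ), HasDerivWithinAt θ (θ' t) (Ici 0) t)
    (hθ' : Tendsto θ' atTop (𝓝 0)) (hwθ : Tendsto (fun t => inner ℝ (w t) (θ t)) atTop (𝓝 0)) :
    Tendsto θ atTop (𝓝 0) := by
  obtain ⟨T, hT, δ, hδ, hp⟩ := h.le_integral hw
  obtain ⟨B, hB0, hB⟩ := hwb.exists_pos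
  rw [Metric.tendsto_atTop] at hwθ hθ' ⊢
  simp only [dist_zero_right] at *
  intro ε hε
  -- If `|⟨w, θ⟩|` and `‖θ'‖` are at most `η`, replacing `θ s` by `θ t` within a window costs at
  -- most `BηT`. Hence `δ‖θ t‖² ≤ η²(1 + BT)²T`.
  obtain ⟨η, hη, hηε⟩ : ∃ η > (0 : ℝ), η ^ 2 * ((1 + B * T) ^ 2 * T) < δ * ε ^ 2 := by
    have hlim : Tendsto (fun η : ℝ => η ^ 2 * ((1 + B * T) ^ 2 * T)) (𝓝[>] 0) (𝓝 0) := by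
      have : Tendsto (fun η : ℝ => η ^ 2 * ((1 + B * T) ^ 2 * T)) (𝓝 0) (𝓝 (0 ^ 2 * _)) :=
        ((continuous_pow 2).mul continuous_const).tendsto 0
      simp only [ne_eq, OfNat.ofNat_ne_zero, not_false_eq_true, zero_pow, zero_mul] at this
      exact this.mono_left nhdsWithin_le_nhds
    obtain ⟨η, h1, h2⟩ := ((hlim.eventually_lt_const (show 0 < δ * ε ^ 2 by positivity)).and
      self_mem_nhdsWithin).exists
    exact ⟨η, h2, h1⟩
  obtain ⟨N₁, hN₁⟩ := hθ' η hη
  obtain ⟨N₂, hN₂⟩ := hwθ η hη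
  refine ⟨max 0 (max N₁ N₂), fun t ht => ?_⟩
  have ht0 : 0 ≤ t := (le_max_left _ _).trans ht
  have ht1 : N₁ ≤ t := ((le_max_left _ _).trans (le_max_right _ _)).trans ht
  have ht2 : N₂ ≤ t := ((le_max_right _ _).trans (le_max_right _ _)).trans ht
  have hI : ∀ s ∈ Icc t (t + T), (inner ℝ (w s) (θ t)) ^ 2 ≤ η ^ 2 * (1 + B * T) ^ 2 := by
    intro s hs
    have hmv := (convex_Icc t (t + T)).norm_image_sub_le_of_norm_hasDerivWithin_le
      (f := θ) (f' := θ') (C := η)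
      (fun r hr => (hθ r (ht0.trans hr.1)).mono fun q hq => ht0.trans hq.1)
      (fun r hr => (hN₁ r (ht1.trans hr.1)).le) (left_mem_Icc.2 (by linarith)) hs
    have h1 : inner ℝ (w s) (θ t) = inner ℝ (w s) (θ s) - inner ℝ (w s) (θ s - θ t) := by
      rw [inner_sub_right]; ring
    have h2 : |inner ℝ (w s) (θ t)| ≤ η * (1 + B * T) := by
      rw [h1]
      refine (abs_sub _ _).trans ?_
      have h3 : |inner ℝ (w s) (θ s)| ≤ η := (hN₂ s (ht2.trans hs.1)).le
      have h4 : |inner ℝ (w s) (θ s - θ t)| ≤ B * (η * T) := by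
        refine (abs_real_inner_le_norm _ _).trans ?_
        refine mul_le_mul (hB s (ht0.trans hs.1)) (hmv.trans ?_) (norm_nonneg _) hB0.le
        gcongr
        rw [Real.norm_of_nonneg (by linarith [hs.1])]
        linarith [hs.2]
      linarith
    rw [← mul_pow]
    exact sq_le_sq' (by linarith [(abs_le.1 h2).1]) (abs_le.1 h2).2
  have hint : ∫ s in t..(t + T), (inner ℝ (w s) (θ t)) ^ 2 ≤ η ^ 2 * (1 + B * T) ^ 2 * T := by
    have := intervalIntegral.norm_integral_le_of_norm_le_const (a := t) (b := t + T)
      (f := fun s => (inner ℝ (w s) (θ t)) ^ 2) (C := η ^ 2 * (1 + B * T) ^ 2) (fun s hs => by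
        rw [uIoc_of_le (by linarith)] at hs
        rw [Real.norm_of_nonneg (sq_nonneg _)]
        exact hI s ⟨hs.1.le, hs.2⟩)
    rw [add_sub_cancel_left, abs_of_pos hT] at this
    exact (Real.le_norm_self _).trans this
  have hfin : ‖θ t‖ ^ 2 < ε ^ 2 := by
    have := (hp t ht0 (θ t)).trans hint
    have h5 : δ * ‖θ t‖ ^ 2 < δ * ε ^ 2 := by
      refine this.trans_lt ?_
      rwa [mul_assoc]
    exact lt_of_mul_lt_mul_left h5 hδ.le
  exact lt_of_pow_lt_pow_left₀ 2 hε.le hfin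

end Excitation

end KKLPEB

namespace KKLPEB

/-! ### The gradient estimator with a decaying perturbation. -/

section Gradient

theorem tendsto_inner_zero_of_bounded {X : Type*} [NormedAddCommGroup X] [InnerProductSpace ℝ X]
    {f g : ℝ → X} (hf : IsBoundedSignal f) (hg : Tendsto g atTop (𝓝 0)) :
    Tendsto (fun t => inner ℝ (f t) (g t)) atTop (𝓝 0) := by
  obtain ⟨C, hC0, hC⟩ := hf.exists_pos
  refine squeeze_zero_norm' (a := fun t => C * ‖g t‖) ?_ (by simpa using hg.norm.const_mul C)
  filter_upwards [eventually_ge_atTop 0] with t ht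
  refine (norm_inner_le_norm _ _).trans ?_
  gcongr
  exact hC t ht

theorem tendsto_smul_zero_of_bounded {X : Type*} [NormedAddCommGroup X] [NormedSpace ℝ X]
    {f : ℝ → X} {s : ℝ → ℝ} (hf : IsBoundedSignal f) (hs : Tendsto s atTop (𝓝 0)) :
    Tendsto (fun t => s t • f t) atTop (𝓝 0) := by
  obtain ⟨C, hC0, hC⟩ := hf.exists_pos
  refine squeeze_zero_norm' (a := fun t => ‖s t‖ * C) ?_ (by simpa using hs.norm.mul_const C)
  filter_upwards [eventually_ge_atTop 0] with t ht
  rw [norm_smul]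
  gcongr
  exact hC t ht

open scoped MatrixOrder Matrix.Norms.L2Operator in
/-- A factorization `Γ = Bᵀ B` with invertible `B`, phrased with `B' = Bᵀ` and `C = (Bᵀ)⁻¹`. -/
theorem exists_factorization_of_posDef {n : ℕ} {Γ : Matrix (Fin n) (Fin n) ℝ} (hΓ : Γ.PosDef) :
    ∃ B B' C : E n →L[ℝ] E n, (∀ v, C (Matrix.toEuclideanLin Γ v) = B v) ∧
      (∀ v, B' (C v) = v) ∧ ∀ v w, inner ℝ (B v) w = inner ℝ v (B' w) := by
  obtain ⟨y, hy, rfl⟩ := CStarAlgebra.isStrictlyPositive_iff_eq_star_mul_self.mp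
    hΓ.isStrictlyPositive
  lift y to (Matrix (Fin n) (Fin n) ℝ)ˣ using hy
  let φ := Matrix.toEuclideanCLM (n := Fin n) (𝕜 := ℝ)
  refine ⟨φ y, φ (star (y : Matrix (Fin n) (Fin n) ℝ)), φ (star (↑y⁻¹ : Matrix (Fin n) (Fin n) ℝ)),
    fun v => ?_, fun v => ?_, fun v w => ?_⟩
  · have h : φ (star (↑y⁻¹ : Matrix (Fin n) (Fin n) ℝ)) *
        φ (star (y : Matrix (Fin n) (Fin n) ℝ) * y) = φ y := by
      rw [← map_mul, ← mul_assoc, ← star_mul]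
      simp
    exact congrArg (fun L : E n →L[ℝ] E n => L v) h
  · have h : φ (star (y : Matrix (Fin n) (Fin n) ℝ)) *
        φ (star (↑y⁻¹ : Matrix (Fin n) (Fin n) ℝ)) = 1 := by
      rw [← map_mul, ← star_mul]
      simp
    exact congrArg (fun L : E n →L[ℝ] E n => L v) h
  · rw [map_star, ContinuousLinearMap.star_eq_adjoint, ContinuousLinearMap.adjoint_inner_right]

/-- Convergence of the parameter error of the perturbed gradient estimator. -/
theorem gradient_tendsto_zero {n : ℕ} {Γ : Matrix (Fin n) (Fin n) ℝ} (hΓ : Γ.PosDef)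
    {α : ℝ} (hα : 0 < α) {w g ψ θ : ℝ → E n} {r : ℝ → ℝ}
    (hwu : UniformContinuousOn w (Ici 0)) (hwb : IsBoundedSignal w)
    (hpe : IsPersistentlyExciting w) (hgb : IsBoundedSignal g)
    (hgw : Tendsto (fun t => g t - w t) atTop (𝓝 0))
    (hψ : ∀ t ∈ Ici (0 : ℝ), HasDerivWithinAt ψ (-(α • ψ t) + α • g t) (Ici 0) t)
    (hr : ExpDecay r)
    (hθ : ∀ t ∈ Ici (0 : ℝ), HasDerivWithinAt θ
      ((r t - inner ℝ (ψ t) (θ t)) • Matrix.toEuclideanLin Γ (ψ t)) (Ici 0) t) :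
    IsBoundedSignal θ ∧ Tendsto θ atTop (𝓝 0) := by
  have hψb : IsBoundedSignal ψ :=
    IsBoundedSignal.filter hα hψ (hgb.comp_continuous (continuous_const_smul α))
  obtain ⟨B, B', C, hCΓ, hBC, hBB⟩ := exists_factorization_of_posDef hΓ
  obtain ⟨c, l, hl, hc⟩ := hr
  set e : ℝ → ℝ := fun t => inner ℝ (ψ t) (θ t) with he
  -- As `Γ = BᵀB` and `C = (Bᵀ)⁻¹`, this is the Lyapunov function `θᵀ Γ⁻¹ θ`.
  let V : ℝ → ℝ := fun t => ‖C (θ t)‖ ^ 2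
  -- The added term is the integral over `[t, ∞)` of the bound `c² e^{-2ls}` for `r²`; it absorbs
  -- the perturbation.
  let W : ℝ → ℝ := fun t => V t + c ^ 2 / (2 * l) * Real.exp (-(2 * l) * t)
  have hV : ∀ t ∈ Ici (0 : ℝ), HasDerivWithinAt V (2 * ((r t - e t) * e t)) (Ici 0) t := by
    intro t ht
    have h1 := (C.hasFDerivAt.comp_hasDerivWithinAt t (hθ t ht)).norm_sq
    refine h1.congr_deriv ?_
    rw [map_smul, hCΓ, Function.comp_apply, inner_smul_right,
      real_inner_comm (B (ψ t)) (C (θ t)), hBB, hBC]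
  have hW : ∀ t ∈ Ici (0 : ℝ), HasDerivWithinAt W
      (2 * ((r t - e t) * e t) - c ^ 2 * Real.exp (-(2 * l) * t)) (Ici 0) t := by
    intro t ht
    have h2 := ((((hasDerivAt_id t).const_mul (-(2 * l))).exp).const_mul
      (c ^ 2 / (2 * l))).hasDerivWithinAt (s := Ici 0)
    refine ((hV t ht).add h2).congr_deriv ?_
    simp only [id]
    field_simp
    ring
  have hWanti : AntitoneOn W (Ici 0) := by
    refine antitoneOn_of_hasDerivWithinAt_nonpos (convex_Ici 0)
      (fun t ht => (hW t ht).continuousWithinAt)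
      (fun t ht => (hW t (interior_subset ht)).mono interior_subset) fun t ht => ?_
    have ht0 : t ∈ Ici (0 : ℝ) := interior_subset ht
    have h1 : r t ^ 2 ≤ c ^ 2 * Real.exp (-(2 * l) * t) := by
      have h2 := pow_le_pow_left₀ (norm_nonneg _) (hc t ht0) 2
      rw [mul_pow, ← Real.exp_nat_mul, Real.norm_eq_abs, sq_abs] at h2
      rwa [show ((2 : ℕ) : ℝ) * -(l * t) = -(2 * l) * t by push_cast; ring] at h2
    nlinarith [sq_nonneg (r t - e t), sq_nonneg (e t)]
  have hW0 : ∀ t, V t ≤ W t := fun t => by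
    have : 0 ≤ c ^ 2 / (2 * l) * Real.exp (-(2 * l) * t) := by positivity
    simp only [W]; linarith
  have hV0 : ∀ t, 0 ≤ V t := fun t => sq_nonneg _
  obtain ⟨v, hv⟩ := exists_tendsto_of_antitoneOn hWanti fun t _ => (hV0 t).trans (hW0 t)
  have hVlim : Tendsto V atTop (𝓝 v) := by
    have h1 : Tendsto (fun t : ℝ => c ^ 2 / (2 * l) * Real.exp (-(2 * l) * t)) atTop (𝓝 0) := by
      have := (Real.tendsto_exp_neg_atTop_nhds_zero.comp
        (tendsto_id.const_mul_atTop (show 0 < 2 * l by positivity))).const_mul (c ^ 2 / (2 * l))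
      simpa [Function.comp_def] using this
    have := hv.sub h1
    simpa [W] using this
  have hθb : IsBoundedSignal θ := by
    -- From `a ≤ a² + 1` with `a = ‖C θ‖`, which avoids a square root.
    refine ⟨‖B'‖ * (W 0 + 1), fun t ht => ?_⟩
    rw [← hBC (θ t)]
    refine (B'.le_opNorm _).trans ?_
    gcongr
    have h1 : V t ≤ W 0 := (hW0 t).trans (hWanti (mem_Ici.2 le_rfl) ht ht)
    simp only [V] at h1
    nlinarith [sq_nonneg (‖C (θ t)‖ - 1), norm_nonneg (C (θ t))]
  have hr : ExpDecay r := ⟨c, l, hl, hc⟩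
  have hΓc : Continuous fun v : E n => Matrix.toEuclideanLin Γ v :=
    LinearMap.continuous_of_finiteDimensional _
  have hΓψ : IsBoundedSignal fun t => Matrix.toEuclideanLin Γ (ψ t) := hψb.comp_continuous hΓc
  have hθ'b : IsBoundedSignal fun t =>
      (r t - inner ℝ (ψ t) (θ t)) • Matrix.toEuclideanLin Γ (ψ t) := by
    have hF : Continuous fun p : ℝ × E n × E n =>
        (p.1 - inner ℝ p.2.1 p.2.2) • Matrix.toEuclideanLin Γ p.2.1 :=
      (continuous_fst.sub (continuous_snd.fst.inner continuous_snd.snd)).smul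
        (hΓc.comp continuous_snd.fst)
    exact (hr.bounded.prodMk (hψb.prodMk hθb)).comp_continuous hF
  have hψ'b : IsBoundedSignal fun t => -(α • ψ t) + α • g t :=
    (hψb.comp_continuous (continuous_const_smul α)).neg.add
      (hgb.comp_continuous (continuous_const_smul α))
  have hψu := uniformContinuousOn_of_deriv_bounded hψ hψ'b
  have hθu := uniformContinuousOn_of_deriv_bounded hθ hθ'b
  have heb : IsBoundedSignal e :=
    (hψb.prodMk hθb).comp_continuous (F := fun p : E n × E n => inner ℝ p.1 p.2)
      (continuous_fst.inner continuous_snd)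
  have he0 : Tendsto e atTop (𝓝 0) := by
    have hu : UniformContinuousOn (fun t => -2 * e t ^ 2) (Ici 0) :=
      (hψb.prodMk hθb).uniformContinuousOn_comp
        (F := fun p : E n × E n => -2 * (inner ℝ p.1 p.2) ^ 2)
        (continuous_const.mul ((continuous_fst.inner continuous_snd).pow 2))
        (uniformContinuousOn_prodMk hψu hθu)
    -- The derivative of `V` is `-2e²` plus the vanishing term `2re`.
    have h1 := barbalat hV hVlim hu (by
      have := (tendsto_smul_zero_of_bounded heb hr.tendsto).const_mul 2
      rw [mul_zero] at this
      refine this.congr fun t => ?_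
      simp only [smul_eq_mul]
      ring)
    have h2 : Tendsto (fun t => |e t|) atTop (𝓝 0) := by
      have := (h1.const_mul (-1 / 2)).sqrt
      simp only [mul_zero, Real.sqrt_zero] at this
      refine this.congr fun t => ?_
      rw [← Real.sqrt_sq_eq_abs]
      congr 1; ring
    exact (tendsto_zero_iff_abs_tendsto_zero e).2 h2
  have hθ'0 : Tendsto (fun t => (r t - inner ℝ (ψ t) (θ t)) • Matrix.toEuclideanLin Γ (ψ t))
      atTop (𝓝 0) :=
    tendsto_smul_zero_of_bounded hΓψ (by simpa using hr.tendsto.sub he0)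
  -- The second use of Barbalat: `e' = ⟨ψ, θ'⟩ - αe + α⟨g, θ⟩`, and every term vanishes except `α⟨w,
  -- θ⟩`. Uniform continuity of `w` is needed here.
  have hwθ : Tendsto (fun t => α * inner ℝ (w t) (θ t)) atTop (𝓝 0) := by
    refine barbalat (F := e) (fun t ht => (hψ t ht).inner ℝ (hθ t ht)) he0
      ((hwb.prodMk hθb).uniformContinuousOn_comp
        (F := fun p : E n × E n => α * inner ℝ p.1 p.2)
        (continuous_const.mul (continuous_fst.inner continuous_snd))
        (uniformContinuousOn_prodMk hwu hθu)) ?_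
    have h1 := tendsto_inner_zero_of_bounded hψb hθ'0
    have h2 := (tendsto_inner_zero_of_bounded hθb hgw).const_mul α
    have h3 := (h1.sub (he0.const_mul α)).add h2
    simp only [mul_zero, sub_zero, add_zero] at h3
    refine h3.congr fun t => ?_
    simp only [he, inner_add_left, inner_neg_left, inner_smul_left, inner_sub_right,
      real_inner_comm (g t) (θ t), real_inner_comm (w t) (θ t), conj_trivial]
    ring
  refine ⟨hθb, hpe.tendsto_zero hwu.continuousOn hwb hθ hθ'0 ?_⟩
  have := hwθ.const_mul α⁻¹
  rw [mul_zero] at this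
  refine this.congr fun t => ?_
  rw [inv_mul_cancel_left₀ hα.ne']

end Gradient

end KKLPEB

namespace KKLPEB

/-! ### Convergence and global existence for the observer. -/

section Observer

/-- A signal with exponentially decaying derivative converges exponentially fast. -/
theorem ExpDecay.exists_limit {X : Type*} [NormedAddCommGroup X] [NormedSpace ℝ X]
    [CompleteSpace X] {d d' : ℝ → X}
    (hd : ∀ t ∈ Ici (0 : ℝ), HasDerivWithinAt d (d' t) (Ici 0) t) (hd' : ExpDecay d') :
    ∃ θ : X, ExpDecay fun t => d t - θ := by
  obtain ⟨C, hC0, l, hl, hC⟩ := hd'.exists_pos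
  have key : ∀ s t : ℝ, 0 ≤ s → s ≤ t → ‖d t - d s‖ ≤ C / l * Real.exp (-(l * s)) := by
    intro s t hs hst
    have hB : ∀ r : ℝ, HasDerivAt (fun r => C / l * Real.exp (-(l * s)) - C / l *
        Real.exp (-l * r)) (C * Real.exp (-(l * r))) r := by
      intro r
      have h := ((((hasDerivAt_id r).const_mul (-l)).exp).const_mul (C / l)).const_sub
        (C / l * Real.exp (-(l * s)))
      refine h.congr_deriv ?_
      simp only [id, neg_mul]
      field_simp
    have h1 := image_norm_le_of_norm_deriv_right_le_deriv_boundary (a := s) (b := t)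
      (f := fun r => d r - d s) (f' := d')
      (fun r hr => (((hd r (hs.trans hr.1)).mono
        (fun q hq => hs.trans hq.1)).sub_const _).continuousWithinAt)
      (fun r hr => ((hd r (hs.trans hr.1)).mono (Ici_subset_Ici.2 (hs.trans hr.1))).sub_const _)
      (B := _) (B' := _) (by simp) hB (fun r hr => hC r (hs.trans hr.1)) (right_mem_Icc.2 hst)
    refine h1.trans (sub_le_self _ (by positivity))
  -- The signal is controlled only on `[0, ∞)`, so time is clamped at `0`.
  have hcauchy : CauchySeq fun t => d (max t 0) := by
    refine cauchySeq_of_le_tendsto_0 (fun t => C / l * Real.exp (-(l * t)) +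
      C / l * Real.exp (-(l * t))) ?_ ?_
    · intro n m N hn hm
      have h : ∀ q, N ≤ q → ‖d (max q 0) - d (max N 0)‖ ≤ C / l * Real.exp (-(l * N)) := by
        intro q hq
        refine (key _ _ (le_max_right _ _) (max_le_max_right _ hq)).trans ?_
        gcongr
        exact le_max_left _ _
      rw [dist_eq_norm, ← sub_sub_sub_cancel_right _ _ (d (max N 0))]
      exact (norm_sub_le _ _).trans (add_le_add (h n hn) (h m hm))
    · have h := (Real.tendsto_exp_neg_atTop_nhds_zero.comp
        (tendsto_id.const_mul_atTop hl)).const_mul (C / l)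
      simpa using h.add h
  obtain ⟨θ, hθ⟩ := cauchySeq_tendsto_of_complete hcauchy
  refine ⟨θ, C / l, l, hl, fun s hs => ?_⟩
  have h1 : Tendsto (fun t => ‖d (max t 0) - d s‖) atTop (𝓝 ‖θ - d s‖) :=
    (hθ.sub_const _).norm
  rw [norm_sub_rev]
  refine le_of_tendsto h1 ?_
  filter_upwards [eventually_ge_atTop s] with t ht
  exact key s _ hs (ht.trans (le_max_left _ _))

theorem ExpDecay.inner_left {X : Type*} [NormedAddCommGroup X] [InnerProductSpace ℝ X]
    {f g : ℝ → X} (hf : ExpDecay f) (hg : IsBoundedSignal g) :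
    ExpDecay fun t => inner ℝ (f t) (g t) := by
  obtain ⟨C, hC⟩ := hg
  refine hf.of_norm_le C fun t ht => (norm_inner_le_norm _ _).trans ?_
  rw [mul_comm]
  gcongr
  exact hC t ht

theorem ExpDecay.inner_right {X : Type*} [NormedAddCommGroup X] [InnerProductSpace ℝ X]
    {f g : ℝ → X} (hf : IsBoundedSignal f) (hg : ExpDecay g) :
    ExpDecay fun t => inner ℝ (f t) (g t) := by
  simpa only [real_inner_comm] using hg.inner_left hf

theorem derivWithin_fst {X Y : Type*} [NormedAddCommGroup X] [NormedSpace ℝ X]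
    [NormedAddCommGroup Y] [NormedSpace ℝ Y] {f f' : ℝ → X × Y}
    (h : ∀ t ∈ Ici (0 : ℝ), HasDerivWithinAt f (f' t) (Ici 0) t) :
    ∀ t ∈ Ici (0 : ℝ), HasDerivWithinAt (fun t => (f t).1) (f' t).1 (Ici 0) t :=
  fun t ht => (ContinuousLinearMap.fst ℝ X Y).hasFDerivAt.comp_hasDerivWithinAt t (h t ht)

theorem derivWithin_snd {X Y : Type*} [NormedAddCommGroup X] [NormedSpace ℝ X]
    [NormedAddCommGroup Y] [NormedSpace ℝ Y] {f f' : ℝ → X × Y}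
    (h : ∀ t ∈ Ici (0 : ℝ), HasDerivWithinAt f (f' t) (Ici 0) t) :
    ∀ t ∈ Ici (0 : ℝ), HasDerivWithinAt (fun t => (f t).2) (f' t).2 (Ici 0) t :=
  fun t ht => (ContinuousLinearMap.snd ℝ X Y).hasFDerivAt.comp_hasDerivWithinAt t (h t ht)

theorem ExpDecay.zero {X : Type*} [NormedAddCommGroup X] : ExpDecay fun _ : ℝ => (0 : X) :=
  ⟨0, 1, one_pos, fun t _ => by simp⟩

/-- Boundedness and convergence of the observer, component by component. -/
theorem observer_convergence {n₁ n₂ n₃ n₄ m : ℕ} (sys : CascadeSystem n₁ n₂ n₃ n₄ m)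
    (k : Fin n₁) (b : E n₁ × E n₂ × E n₃ × E m → E n₄) (hb : ContDiff ℝ ∞ b)
    (hS : ∀ x₁ x₂ x₃ x₄ u, sys.S ((x₁, x₂, x₃, x₄), u) k = inner ℝ (b (x₁, x₂, x₃, u)) x₄)
    (hA₂ : IsHurwitz sys.A₂) (hA₃ : IsHurwitz sys.A₃)
    {u : ℝ → E m} (hu : IsBoundedSignal u)
    {x₁ : ℝ → E n₁} {x₂ : ℝ → E n₂} {x₃ : ℝ → E n₃} {x₄ : ℝ → E n₄}
    (hx₁ : ∀ t ∈ Ici (0 : ℝ), HasDerivWithinAt x₁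
      (sys.f₁ (x₁ t, x₂ t, x₃ t, u t) + sys.S ((x₁ t, x₂ t, x₃ t, x₄ t), u t)) (Ici 0) t)
    (hx₂ : ∀ t ∈ Ici (0 : ℝ), HasDerivWithinAt x₂
      (Matrix.toEuclideanLin sys.A₂ (x₂ t) + sys.f₂ (x₁ t, u t)) (Ici 0) t)
    (hx₃ : ∀ t ∈ Ici (0 : ℝ), HasDerivWithinAt x₃
      (Matrix.toEuclideanLin sys.A₃ (x₃ t) + sys.f₃ (x₁ t, x₂ t, u t)) (Ici 0) t)
    (hx₄ : ∀ t ∈ Ici (0 : ℝ), HasDerivWithinAt x₄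
      (sys.f₄ (x₁ t, x₂ t, x₃ t, u t)) (Ici 0) t)
    (hb₁ : IsBoundedSignal x₁) (hb₂ : IsBoundedSignal x₂) (hb₃ : IsBoundedSignal x₃)
    (hb₄ : IsBoundedSignal x₄)
    (huc : UniformContinuousOn (fun t => b (x₁ t, x₂ t, x₃ t, u t)) (Ici 0))
    (hpe : IsPersistentlyExciting fun t => b (x₁ t, x₂ t, x₃ t, u t))
    {α : ℝ} (hα : 0 < α) {Γ : Matrix (Fin n₄) (Fin n₄) ℝ} (hΓ : Γ.PosDef)
    {z₂ : ℝ → E n₂} {z₃ : ℝ → E n₃} {ξ : ℝ → E n₄} {zy zf zb : ℝ → ℝ} {ψ θ : ℝ → E n₄}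
    (hz₂ : ∀ t ∈ Ici (0 : ℝ), HasDerivWithinAt z₂
      (Matrix.toEuclideanLin sys.A₂ (z₂ t) + sys.f₂ (x₁ t, u t)) (Ici 0) t)
    (hz₃ : ∀ t ∈ Ici (0 : ℝ), HasDerivWithinAt z₃
      (Matrix.toEuclideanLin sys.A₃ (z₃ t) + sys.f₃ (x₁ t, z₂ t, u t)) (Ici 0) t)
    (hξ : ∀ t ∈ Ici (0 : ℝ), HasDerivWithinAt ξ
      (sys.f₄ (x₁ t, z₂ t, z₃ t, u t)) (Ici 0) t)
    (hzy : ∀ t ∈ Ici (0 : ℝ), HasDerivWithinAt zy (lowPass α (zy t) (x₁ t k)) (Ici 0) t)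
    (hzf : ∀ t ∈ Ici (0 : ℝ), HasDerivWithinAt zf
      (lowPass α (zf t) (sys.f₁ (x₁ t, z₂ t, z₃ t, u t) k)) (Ici 0) t)
    (hzb : ∀ t ∈ Ici (0 : ℝ), HasDerivWithinAt zb
      (lowPass α (zb t) (inner ℝ (b (x₁ t, z₂ t, z₃ t, u t)) (ξ t))) (Ici 0) t)
    (hψ : ∀ t ∈ Ici (0 : ℝ), HasDerivWithinAt ψ
      (lowPass α (ψ t) (b (x₁ t, z₂ t, z₃ t, u t))) (Ici 0) t)
    (hθ : ∀ t ∈ Ici (0 : ℝ), HasDerivWithinAt θ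
      ((regressand k α (x₁ t) (zy t) (zf t) (zb t) - inner ℝ (ψ t) (θ t)) •
        Matrix.toEuclideanLin Γ (ψ t)) (Ici 0) t) :
    (IsBoundedSignal z₂ ∧ IsBoundedSignal z₃ ∧ IsBoundedSignal ξ ∧ IsBoundedSignal zy ∧
      IsBoundedSignal zf ∧ IsBoundedSignal zb ∧ IsBoundedSignal ψ ∧ IsBoundedSignal θ) ∧
    Tendsto (fun t => z₂ t - x₂ t) atTop (𝓝 0) ∧ Tendsto (fun t => z₃ t - x₃ t) atTop (𝓝 0) ∧
    ∃ θ₀ : E n₄, Tendsto (fun t => x₄ t - ξ t) atTop (𝓝 θ₀) ∧ Tendsto θ atTop (𝓝 θ₀) := by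
  have he₂ : ExpDecay fun t => z₂ t - x₂ t :=
    hA₂.expDecay (g := fun _ => 0) (fun t ht => ((hz₂ t ht).sub (hx₂ t ht)).congr_deriv (by
      rw [map_sub]; abel)) ExpDecay.zero
  have hbz₂ : IsBoundedSignal z₂ := (he₂.bounded.add hb₂).congr fun t _ => by simp
  have he₃ : ExpDecay fun t => z₃ t - x₃ t :=
    hA₃.expDecay (g := fun t => sys.f₃ (x₁ t, z₂ t, u t) - sys.f₃ (x₁ t, x₂ t, u t))
      (fun t ht => ((hz₃ t ht).sub (hx₃ t ht)).congr_deriv (by rw [map_sub]; abel))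
      (ExpDecay.comp_contDiff sys.smooth_f₃ (hb₁.prodMk (hbz₂.prodMk hu))
        (hb₁.prodMk (hb₂.prodMk hu))
        ((ExpDecay.zero.prodMk (he₂.prodMk ExpDecay.zero)).congr fun t _ => by simp))
  have hbz₃ : IsBoundedSignal z₃ := (he₃.bounded.add hb₃).congr fun t _ => by simp
  have hp := hb₁.prodMk (hb₂.prodMk (hb₃.prodMk hu))
  have hq := hb₁.prodMk (hbz₂.prodMk (hbz₃.prodMk hu))
  have hpq : ExpDecay fun t => (x₁ t, x₂ t, x₃ t, u t) - (x₁ t, z₂ t, z₃ t, u t) :=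
    (ExpDecay.zero.prodMk (he₂.neg.prodMk (he₃.neg.prodMk ExpDecay.zero))).congr
      fun t _ => by simp
  obtain ⟨θ₀, hθ₀⟩ := ExpDecay.exists_limit (d := fun t => x₄ t - ξ t)
    (fun t ht => (hx₄ t ht).sub (hξ t ht)) (ExpDecay.comp_contDiff sys.smooth_f₄ hp hq hpq)
  have hθ₀b : IsBoundedSignal fun _ : ℝ => θ₀ := ⟨‖θ₀‖, fun _ _ => le_rfl⟩
  -- `ξ` is an open integrator; it is bounded only because it follows `x₄` up to the constant `θ₀`
  -- and a decaying error.
  have hbξ : IsBoundedSignal ξ := ((hb₄.sub hθ₀b).sub hθ₀.bounded).congr fun t _ => by abel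
  have hbw : IsBoundedSignal fun t => b (x₁ t, x₂ t, x₃ t, u t) :=
    hp.comp_continuous hb.continuous
  have hbg : IsBoundedSignal fun t => b (x₁ t, z₂ t, z₃ t, u t) :=
    hq.comp_continuous hb.continuous
  have hdb := ExpDecay.comp_contDiff hb hp hq hpq
  have hsc : ∀ {w : ℝ → ℝ}, IsBoundedSignal w → IsBoundedSignal fun t => α • w t :=
    fun hw => hw.comp_continuous (continuous_const_smul α)
  have hbzy : IsBoundedSignal zy := IsBoundedSignal.filter hα hzy
    (hsc (hb₁.of_norm_le fun t _ => PiLp.norm_apply_le (x₁ t) k))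
  have hbzf : IsBoundedSignal zf := IsBoundedSignal.filter hα hzf
    (hsc ((hq.comp_continuous sys.smooth_f₁.continuous).of_norm_le
      fun t _ => PiLp.norm_apply_le (sys.f₁ (x₁ t, z₂ t, z₃ t, u t)) k))
  have hbzb : IsBoundedSignal zb := IsBoundedSignal.filter hα hzb
    (hsc ((hbg.prodMk hbξ).comp_continuous (F := fun p : E n₄ × E n₄ => inner ℝ p.1 p.2)
      (continuous_fst.inner continuous_snd)))
  have hbψ : IsBoundedSignal ψ := IsBoundedSignal.filter hα hψ
    (hbg.comp_continuous (continuous_const_smul α))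
  -- the filtered regression equation holds up to a decaying error
  have hε : ExpDecay fun t =>
      ((sys.f₁ (x₁ t, x₂ t, x₃ t, u t) - sys.f₁ (x₁ t, z₂ t, z₃ t, u t)) k +
        inner ℝ (b (x₁ t, x₂ t, x₃ t, u t) - b (x₁ t, z₂ t, z₃ t, u t)) (x₄ t)) +
      inner ℝ (b (x₁ t, z₂ t, z₃ t, u t)) (x₄ t - ξ t - θ₀) :=
    (((ExpDecay.comp_contDiff sys.smooth_f₁ hp hq hpq).of_norm_le 1 fun t _ => by
      rw [one_mul]; exact PiLp.norm_apply_le _ k).add (hdb.inner_left hb₄)).add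
      (ExpDecay.inner_right hbg hθ₀)
  have hr : ExpDecay fun t =>
      regressand k α (x₁ t) (zy t) (zf t) (zb t) - inner ℝ (ψ t) θ₀ := by
    -- All filters share the pole `-α`, so the regression residual `r` solves `r' = -αr + αε`, where
    -- `ε` is the decaying mismatch just estimated.
    refine ExpDecay.filter hα (fun t ht => ?_)
      (hε.of_norm_le (f := fun t => α • _) ‖α‖ fun t _ => (norm_smul _ _).le)
    have hy : HasDerivWithinAt (fun t => x₁ t k) ((sys.f₁ (x₁ t, x₂ t, x₃ t, u t) +
        sys.S ((x₁ t, x₂ t, x₃ t, x₄ t), u t)) k) (Ici 0) t :=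
      (EuclideanSpace.proj (𝕜 := ℝ) k).hasFDerivAt.comp_hasDerivWithinAt t (hx₁ t ht)
    have h := (((((hy.sub (hzy t ht)).const_mul α).sub (hzf t ht)).sub (hzb t ht))).sub
      ((hψ t ht).inner ℝ (hasDerivWithinAt_const t (Ici 0) θ₀))
    refine h.congr_deriv ?_
    simp only [lowPass, regressand, inner_zero_right, zero_add, inner_add_left, inner_neg_left,
      inner_smul_left, inner_sub_left, inner_sub_right, conj_trivial, smul_eq_mul,
      PiLp.add_apply, PiLp.sub_apply, hS]
    ring
  have hθt : ∀ t ∈ Ici (0 : ℝ), HasDerivWithinAt (fun t => θ t - θ₀)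
      ((regressand k α (x₁ t) (zy t) (zf t) (zb t) - inner ℝ (ψ t) θ₀ -
        inner ℝ (ψ t) (θ t - θ₀)) • Matrix.toEuclideanLin Γ (ψ t)) (Ici 0) t := fun t ht => by
    refine ((hθ t ht).sub_const θ₀).congr_deriv ?_
    rw [inner_sub_right]
    congr 1
    ring
  obtain ⟨hθb, hθlim⟩ := gradient_tendsto_zero hΓ hα huc hbw hpe hbg
    (by simpa using hdb.neg.tendsto) hψ hr hθt
  exact ⟨⟨hbz₂, hbz₃, hbξ, hbzy, hbzf, hbzb, hbψ, (hθb.add hθ₀b).congr fun t _ => by simp⟩,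
    he₂.tendsto, he₃.tendsto, θ₀, tendsto_sub_nhds_zero_iff.1 hθ₀.tendsto,
    tendsto_sub_nhds_zero_iff.1 hθlim⟩

/-- Global existence for the observer. -/
theorem exists_observer_solution {n₁ n₂ n₃ n₄ m : ℕ} (sys : CascadeSystem n₁ n₂ n₃ n₄ m)
    (k : Fin n₁) {b : E n₁ × E n₂ × E n₃ × E m → E n₄} (hb : Continuous b)
    {u : ℝ → E m} (hu : ContinuousOn u (Ici 0)) {y : ℝ → E n₁} (hy : ContinuousOn y (Ici 0))
    (α : ℝ) (Γ : Matrix (Fin n₄) (Fin n₄) ℝ) (χ₀ : ObserverState n₂ n₃ n₄) :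
    ∃ χ : ℝ → ObserverState n₂ n₃ n₄, χ 0 = χ₀ ∧
      IsSolution (fun t z => observerField sys k b α Γ (y t) z (u t)) χ := by
  obtain ⟨a₂, a₃, aξ, ay, af, ab, aψ, aθ⟩ := χ₀
  have hcont : ∀ {X : Type} [NormedAddCommGroup X] [NormedSpace ℝ X] {z z' : ℝ → X},
      (∀ t ∈ Ici (0 : ℝ), HasDerivWithinAt z (z' t) (Ici 0) t) → ContinuousOn z (Ici 0) :=
    fun h t ht => (h t ht).continuousWithinAt
  have hlow : ∀ {X : Type} [NormedAddCommGroup X] [NormedSpace ℝ X] [FiniteDimensional ℝ X]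
      {w : ℝ → X}, ContinuousOn w (Ici 0) → ∀ a : X, ∃ z : ℝ → X, z 0 = a ∧
        ∀ t ∈ Ici (0 : ℝ), HasDerivWithinAt z (lowPass α (z t) (w t)) (Ici 0) t :=
    fun hw a => exists_linear (A := fun _ => -(α • ContinuousLinearMap.id ℝ _))
      continuousOn_const (hw.const_smul α) a
  have hproj : Continuous fun v : E n₁ => v k := (EuclideanSpace.proj (𝕜 := ℝ) k).continuous
  obtain ⟨z₂, h₂0, h₂⟩ := exists_linear
    (A := fun _ => LinearMap.toContinuousLinearMap (Matrix.toEuclideanLin sys.A₂))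
    (g := fun t => sys.f₂ (y t, u t)) continuousOn_const
    (sys.smooth_f₂.continuous.comp_continuousOn (hy.prodMk hu)) a₂
  have hc₂ := hcont h₂
  obtain ⟨z₃, h₃0, h₃⟩ := exists_linear
    (A := fun _ => LinearMap.toContinuousLinearMap (Matrix.toEuclideanLin sys.A₃))
    (g := fun t => sys.f₃ (y t, z₂ t, u t)) continuousOn_const
    (sys.smooth_f₃.continuous.comp_continuousOn (hy.prodMk (hc₂.prodMk hu))) a₃
  have hc₃ := hcont h₃
  have hq := hy.prodMk (hc₂.prodMk (hc₃.prodMk hu))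
  obtain ⟨ξ, hξ0, hξ⟩ := exists_linear (A := fun _ => 0)
    (g := fun t => sys.f₄ (y t, z₂ t, z₃ t, u t)) continuousOn_const
    (sys.smooth_f₄.continuous.comp_continuousOn hq) aξ
  have hcξ := hcont hξ
  have hcb := hb.comp_continuousOn hq
  obtain ⟨zy, hy0, hzy⟩ := hlow (hproj.comp_continuousOn hy) ay
  obtain ⟨zf, hf0, hzf⟩ := hlow
    (hproj.comp_continuousOn (sys.smooth_f₁.continuous.comp_continuousOn hq)) af
  obtain ⟨zb, hb0, hzb⟩ := hlow (hcb.inner hcξ) ab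
  obtain ⟨ψ, hψ0, hψ⟩ := hlow hcb aψ
  have hcψ := hcont hψ
  have hcΓ : ContinuousOn (fun t => Matrix.toEuclideanLin Γ (ψ t)) (Ici 0) :=
    (LinearMap.continuous_of_finiteDimensional (Matrix.toEuclideanLin Γ)).comp_continuousOn hcψ
  -- Once `ψ` and the filters are known, the estimator is linear in `θ` with matrix `-Γψψᵀ`.
  obtain ⟨θ, hθ0, hθ⟩ := exists_linear
    (A := fun t => -(innerSL ℝ (ψ t)).smulRight (Matrix.toEuclideanLin Γ (ψ t)))
    (g := fun t => regressand k α (y t) (zy t) (zf t) (zb t) • Matrix.toEuclideanLin Γ (ψ t))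
    ((((ContinuousLinearMap.smulRightL ℝ (E n₄) (E n₄)).continuous.comp_continuousOn
      ((innerSL ℝ).continuous.comp_continuousOn hcψ)).clm_apply hcΓ).neg)
    (((((hproj.comp_continuousOn hy).sub (hcont hzy)).const_smul α).sub (hcont hzf)).sub
      (hcont hzb) |>.smul hcΓ) aθ
  refine ⟨fun t => (z₂ t, z₃ t, ξ t, zy t, zf t, zb t, ψ t, θ t), ?_, fun t ht => ?_⟩
  · simp only [h₂0, h₃0, hξ0, hy0, hf0, hb0, hψ0, hθ0]
  · refine (h₂ t ht).prodMk <| (h₃ t ht).prodMk <| ((hξ t ht).congr_deriv ?_).prodMk <|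
      (hzy t ht).prodMk <| (hzf t ht).prodMk <| (hzb t ht).prodMk <| (hψ t ht).prodMk <|
      (hθ t ht).congr_deriv ?_
    · simp
    · simp [sub_smul]
      abel

end Observer

end KKLPEB
-- Assembly of the main theorem.
theorem proposition7 {n₁ n₂ n₃ n₄ m : ℕ}
    (sys : KKLPEB.CascadeSystem n₁ n₂ n₃ n₄ m)
    -- (i) the `k`-th component of `S` factorizes
    (k : Fin n₁)
    (b : KKLPEB.E n₁ × KKLPEB.E n₂ × KKLPEB.E n₃ × KKLPEB.E m → KKLPEB.E n₄)
    (hb : ContDiff ℝ ∞ b)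
    (hS : ∀ x₁ x₂ x₃ x₄ u,
      sys.S ((x₁, x₂, x₃, x₄), u) k = inner ℝ (b (x₁, x₂, x₃, u)) x₄)
    -- (ii) Hurwitz matrices
    (hA₂ : KKLPEB.IsHurwitz sys.A₂) (hA₃ : KKLPEB.IsHurwitz sys.A₃)
    -- the input and a trajectory of the plant
    (u : ℝ → KKLPEB.E m) (hu : ContinuousOn u (Ici 0))
    (x : ℝ → KKLPEB.PlantState n₁ n₂ n₃ n₄)
    (hx : KKLPEB.IsSolution (fun t z => sys.field z (u t)) x)
    -- (iii) boundedness and persistency of excitation of the regressor `b(t)`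
    (hu_bdd : KKLPEB.IsBoundedSignal u) (hx_bdd : KKLPEB.IsBoundedSignal x)
    (hb_uc : UniformContinuousOn
      (fun t => b ((x t).1, (x t).2.1, (x t).2.2.1, u t)) (Ici 0))
    (hb_pe : KKLPEB.IsPersistentlyExciting
      (fun t => b ((x t).1, (x t).2.1, (x t).2.2.1, u t)))
    -- the tuning gains
    (α : ℝ) (hα : 0 < α) (Γ : Matrix (Fin n₄) (Fin n₄) ℝ) (hΓ : Γ.PosDef) :
    -- the observer has a solution on `[0, ∞)` from every initial condition
    (∀ χ₀ : KKLPEB.ObserverState n₂ n₃ n₄, ∃ χ : ℝ → KKLPEB.ObserverState n₂ n₃ n₄,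
      χ 0 = χ₀ ∧
      KKLPEB.IsSolution (fun t z => KKLPEB.observerField sys k b α Γ (x t).1 z (u t)) χ) ∧
    -- every solution is bounded, reconstructs the state, and `θ̂` is consistent
    (∀ χ : ℝ → KKLPEB.ObserverState n₂ n₃ n₄,
      KKLPEB.IsSolution (fun t z => KKLPEB.observerField sys k b α Γ (x t).1 z (u t)) χ →
      KKLPEB.IsBoundedSignal χ ∧
      Tendsto (fun t => ‖KKLPEB.observerOutput (x t).1 (χ t) - x t‖) atTop (𝓝 0) ∧
      ∃ θ : KKLPEB.E n₄,
        Tendsto (fun t => (x t).2.2.2 - KKLPEB.ObserverState.xi (χ t)) atTop (𝓝 θ) ∧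
        Tendsto (fun t => KKLPEB.ObserverState.theta (χ t)) atTop (𝓝 θ)) := by
  refine ⟨fun χ₀ => KKLPEB.exists_observer_solution sys k hb.continuous hu
    (fun t ht => (KKLPEB.derivWithin_fst hx t ht).continuousWithinAt) α Γ χ₀, fun χ hχ => ?_⟩
  have c₂ := KKLPEB.derivWithin_snd hχ
  have c₃ := KKLPEB.derivWithin_snd c₂
  have c₄ := KKLPEB.derivWithin_snd c₃
  have c₅ := KKLPEB.derivWithin_snd c₄
  have c₆ := KKLPEB.derivWithin_snd c₅
  have c₇ := KKLPEB.derivWithin_snd c₆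
  obtain ⟨⟨b₂, b₃, bξ, by', bf, bb, bψ, bθ⟩, e₂, e₃, θ, hθ, hθ'⟩ :=
    KKLPEB.observer_convergence sys k b hb hS hA₂ hA₃ hu_bdd
      (KKLPEB.derivWithin_fst hx) (KKLPEB.derivWithin_fst (KKLPEB.derivWithin_snd hx)) (KKLPEB.derivWithin_fst (KKLPEB.derivWithin_snd (KKLPEB.derivWithin_snd hx))) (KKLPEB.derivWithin_snd (KKLPEB.derivWithin_snd (KKLPEB.derivWithin_snd hx)))
      hx_bdd.fst hx_bdd.snd.fst hx_bdd.snd.snd.fst hx_bdd.snd.snd.snd hb_uc hb_pe hα hΓ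
      (KKLPEB.derivWithin_fst hχ) (KKLPEB.derivWithin_fst c₂) (KKLPEB.derivWithin_fst c₃) (KKLPEB.derivWithin_fst c₄) (KKLPEB.derivWithin_fst c₅) (KKLPEB.derivWithin_fst c₆) (KKLPEB.derivWithin_fst c₇) (KKLPEB.derivWithin_snd c₇)
  refine ⟨b₂.prodMk (b₃.prodMk (bξ.prodMk (by'.prodMk (bf.prodMk (bb.prodMk (bψ.prodMk bθ)))))),
    ?_, θ, hθ, hθ'⟩
  -- The fourth error is `ξ + θ̂ - x₄ = θ̂ - (x₄ - ξ)`, a difference of two signals with the same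
  -- limit.
  have e₄ := hθ'.sub hθ
  rw [sub_self] at e₄
  have h := (tendsto_const_nhds (x := (0 : KKLPEB.E n₁))).prodMk_nhds
    (e₂.prodMk_nhds (e₃.prodMk_nhds e₄)) |>.norm
  rw [Prod.mk_zero_zero, Prod.mk_zero_zero, Prod.mk_zero_zero, norm_zero] at h
  refine h.congr fun t => congrArg norm ?_
  refine Prod.ext (sub_self _).symm (Prod.ext rfl (Prod.ext rfl ?_))
  change (χ t).2.2.2.2.2.2.2 - ((x t).2.2.2 - (χ t).2.2.1) =
    ((χ t).2.2.1 + (χ t).2.2.2.2.2.2.2) - (x t).2.2.2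
  abel
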